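/- Throughout, graphs are finite, simple and non-empty, $\log$ is the natural logarithm, and for a graph $G$ we write $|G|$, $e(G)$, $\delta(G)$ and $d(G)=2e(G)/|G|$ for its number of vertices, number of edges, minimum degree and average degree. $N_G(X)$ denotes the set of vertices outside $X$ with a neighbour in $X$, and $G\setminus F$ is $G$ with the edges of $F$ removed. For reals $\varepsilon_1,k>0$, a graph $G$ is an $(\varepsilon_1,k)$-expander if for every $X\subseteq V(G)$ with $k/2\le |X|\le |G|/2$ and every subgraph $F\subseteq G$ with $e(F)\le d(G)\,\varepsilon(|X|)\,|X|$ we have $|N_{G\setminus F}(X)|\ge \varepsilon(|X|)\,|X|$, where $\varepsilon(x)=0$ if $x<k/5$ and $\varepsilon(x)=\varepsilon_1/\log^2(15x/k)$ if $x\ge k/5$. For integers $k\ge 3$, $s\ge 1$ and a real $m>0$, a $(k,m,s)$-kraken $(C,A_{i,j},R_{i,j},u_{i,j})_{i\in[k],j\in[2]}$ in $G$ consists of a cycle $C$ in $G$ with vertices $v_1,\dots,v_k$ in cyclic order; pairwise disjoint sets $A_{i,j}\subseteq V(G)\setminus V(C)$, each of size $s$ and each such that the induced subgraph $G[A_{i,j}]$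 has diameter at most $m$ (in particular, is connected); vertices $u_{i,j}\in A_{i,j}$; and pairwise internally vertex-disjoint paths $R_{i,j}$ in $G$, where $R_{i,j}$ joins $v_i$ to $u_{i,j}$, has length at most $10m$, and has no internal vertex in $V(C)$ or in $A_{i',j'}$ for any $(i',j')\ne(i,j)$. **Lemma.** For every $\varepsilon_1\in(0,1)$ there is $d_0=d_0(\varepsilon_1)>0$ such that the following holds for all real $d\ge d_0$. Let $G$ be an $n$-vertex $(\varepsilon_1,\varepsilon_1 d)$-expander with $\delta(G)\ge d$. Let $L$ be the set of vertices of $G$ of degree at least $\log^{100}n$, and let $m=100\,\varepsilon_1^{-1}\log^3 n$. Then, for some $k\le\log n$, there is a $(k,m,\lceil\log^{10}n\rceil)$-kraken $(C,A_{i,j},R_{i,j},u_{i,j})_{i\in[k],j\in[2]}$ in $G$ such that - either $u_{i,j}\in L$ for all $i\in[k]$, $j\in[2]$; - or $|L|\le 2\log n$, and for all $(i,j)\ne(i',j')$ with $u_{i,j},u_{i',j'}\notin L$, the distance between $u_{i,j}$ and $u_{i',j'}$ in $G-L$ is at least $\sqrt{\log n}$ (the distance being infinite if they lie in different components of $G-L$).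 -/

import Mathlib

namespace KrakenLemma

/-- The average degree `d(G) = 2 e(G) / |G|`. -/
noncomputable def avgDegree {V : Type*} [Fintype V] (G : SimpleGraph V) : ℝ :=
  2 * (G.edgeSet.ncard : ℝ) / (Fintype.card V : ℝ)

/-- The external neighbourhood `N_G(X)`: the vertices at distance exactly one from `X`. -/
def extNbhd {V : Type*} (G : SimpleGraph V) (X : Finset V) : Set V :=
  {y | y ∉ X ∧ ∃ x ∈ X, G.Adj x y}

/-- The expansion rate `ε(x, ε₁, k)`, with the natural logarithm. -/
noncomputable def expRate (ε₁ k x : ℝ) : ℝ :=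
  if x < k / 5 then 0 else ε₁ / Real.log (15 * x / k) ^ 2

/-- `G` is an `(ε₁, k)`-expander. The parameter `k` is real since it is used with `k = ε₁ d`. -/
def IsExpander {V : Type*} [Fintype V] (G : SimpleGraph V) (ε₁ k : ℝ) : Prop :=
  ∀ X : Finset V, k / 2 ≤ (X.card : ℝ) → (X.card : ℝ) ≤ (Fintype.card V : ℝ) / 2 →
    ∀ F : SimpleGraph V, F ≤ G →
      (F.edgeSet.ncard : ℝ) ≤ avgDegree G * expRate ε₁ k X.card * (X.card : ℝ) →
        expRate ε₁ k X.card * (X.card : ℝ) ≤ ((extNbhd (G \ F) X).ncard : ℝ)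

/-- The distance between `x` and `y` in `H` is at least `t`
(it is infinite if no walk joins them). -/
def DistAtLeast {W : Type*} (H : SimpleGraph W) (x y : W) (t : ℝ) : Prop :=
  ∀ w : H.Walk x y, t ≤ (w.length : ℝ)

/-- `H` has diameter at most `t`: any two vertices are joined by a walk of length at most `t`. -/
def DiamAtMost {W : Type*} (H : SimpleGraph W) (t : ℝ) : Prop :=
  ∀ x y : W, ∃ w : H.Walk x y, (w.length : ℝ) ≤ t

/-- The internal vertices of a path. -/
def internalVerts {V : Type*} {G : SimpleGraph V} {a b : V} (w : G.Walk a b) : Set V :=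
  {x | x ∈ w.support ∧ x ≠ a ∧ x ≠ b}

/-- A `(k, m, s)`-kraken `(C, A i j, R i j, u i j)` in the graph `G`. -/
structure Kraken {V : Type*} (G : SimpleGraph V) (k : ℕ) (m : ℝ) (s : ℕ) where
  three_le : 3 ≤ k
  /-- The cycle, with vertices `C i` in cyclic order. -/
  C : SimpleGraph.Copy (SimpleGraph.cycleGraph k) G
  /-- The arm endpoints. -/
  u : Fin k → Fin 2 → V
  /-- The sets at the ends of the arms. -/
  A : Fin k → Fin 2 → Finset V
  /-- The arms. -/
  R : ∀ (i : Fin k) (j : Fin 2), G.Walk (C i) (u i j)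
  u_mem : ∀ i j, u i j ∈ A i j
  card_A : ∀ i j, (A i j).card = s
  A_disjoint_cycle : ∀ i j l, C l ∉ A i j
  A_disjoint : ∀ i j i' j', (i, j) ≠ (i', j') → Disjoint (A i j) (A i' j')
  /-- The diameter is measured inside the subgraph induced on the set. -/
  A_diam : ∀ i j, DiamAtMost (G.induce (A i j : Set V)) m
  R_isPath : ∀ i j, (R i j).IsPath
  R_length : ∀ i j, ((R i j).length : ℝ) ≤ 10 * m
  R_disjoint_cycle : ∀ i j l, C l ∉ internalVerts (R i j)
  R_disjoint_A : ∀ i j i' j', (i, j) ≠ (i', j') →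
    ∀ x ∈ internalVerts (R i j), x ∉ A i' j'
  /-- Pairwise internally disjoint: no internal vertex of one arm lies on another arm. -/
  R_disjoint : ∀ i j i' j', (i, j) ≠ (i', j') →
    ∀ x ∈ internalVerts (R i j), x ∉ (R i' j').support

/-- The set `L` of vertices of degree at least `log ^ 100 n`, where `n = |G|`. -/
def highDegree {V : Type*} [Fintype V] (G : SimpleGraph V) [DecidableRel G.Adj] : Set V :=
  {v | Real.log (Fintype.card V) ^ 100 ≤ (G.degree v : ℝ)}

end KrakenLemma

/-! The cycle is a shortest cycle of `G`: as the minimum degree exceeds a large constant, the girth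
k is at most log n / 4. What remains is a linking problem, to send two disjoint short arms from each
cycle vertex to targets with distinct labels.

If |L| > 2 log n, the targets are the vertices of L off the cycle, each its own label. Otherwise
degrees in G - L are below log^100 n, so one can place many centres that are far in G - L from each
other and from the cycle. Far apart centres cannot all have small balls in an expander
(`exists_large_ball`), so many of them carry a connected cell of the prescribed size; these cells,
each with one label, are targets along with the vertices of L off the cycle. For an arm ending in L,
the set at its end is made of fresh neighbours of that end (`exists_kraken`).

All arms are found at once by minimality. Among partial families of disjoint arms take one of least
total length, a missing arm costing more than any arm. Suppose that a cycle vertex v is unserved. If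
v is in L, its neighbourhood is already large. If not, explore from v the region off the cycle, the
arms and the targets. A route from v that meets an arm can do so only near the beginning of that
arm, for otherwise v would take over its end more cheaply (`Frame.IsOptimal.exchange`). Hence the
ball of radius r loses at most k + 2k(r + 2) neighbours, and expansion makes it grow like (Y + δ(k +
r))^40. To get started, the minimum degree is enough when k is bounded, and for larger k the girth
gives tree-like growth to depth k/8. No unused target is met on the way: one outside L is too far,
and one in L would extend the family.

After about √(log n) steps the ball has log^15 n vertices, while the vertices to be avoided number
at most log^12 n. The usual expander argument (`exists_short_walk`) then joins it to an unused
target, contradicting minimality (`Frame.IsOptimal.ne_none`). -/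

open SimpleGraph

/-! ### Expansion and short connections avoiding a small set -/

namespace KrakenLemma

variable {V : Type*}

/-- The external neighbourhood of a set of vertices. -/
def nbhd (G : SimpleGraph V) (X : Set V) : Set V := {y | y ∉ X ∧ ∃ x ∈ X, G.Adj x y}

/-- The expansion property with the rate `ε / log² x`, for sets of size at least `K`. -/
def Expands [Fintype V] (G : SimpleGraph V) (ε K : ℝ) : Prop :=
  ∀ X : Set V, K ≤ X.ncard → (X.ncard : ℝ) ≤ Fintype.card V / 2 →
    ε * X.ncard / Real.log X.ncard ^ 2 ≤ (nbhd G X).ncard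

/-- Only vertex expansion is needed, so the deleted subgraph is taken empty. Since εd ≥ 15, the
logarithm in the original rate is at most log x, and the rate becomes independent of d. -/
theorem IsExpander.expands [Fintype V] {G : SimpleGraph V} {ε d : ℝ} (h0 : 0 < ε) (h1 : ε < 1)
    (hd : 15 / ε ≤ d) (h : IsExpander G ε (ε * d)) : Expands G ε (d / 2) := by
  classical
  intro X hK hX
  have hdpos : 0 < d := lt_of_lt_of_le (by positivity) hd
  have hεd : 15 ≤ ε * d := by rwa [div_le_iff₀' h0] at hd
  have hεd' : ε * d ≤ d := by nlinarith
  have hcard : X.toFinset.card = X.ncard := (Set.ncard_eq_toFinset_card' X).symm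
  have hn : 0 ≤ avgDegree G := by unfold avgDegree; positivity
  have hrate : expRate ε (ε * d) X.ncard = ε / Real.log (15 * X.ncard / (ε * d)) ^ 2 := by
    unfold expRate
    rw [if_neg]
    push Not
    linarith
  have hrate0 : 0 ≤ expRate ε (ε * d) X.ncard := by rw [hrate]; positivity
  have := h X.toFinset (by rw [hcard]; linarith) (by rwa [hcard]) ⊥ bot_le (by
    rw [hcard]
    simp only [SimpleGraph.edgeSet_bot, Set.ncard_empty, Nat.cast_zero]
    positivity)
  rw [hcard, hrate] at this
  have he : extNbhd (G \ ⊥) X.toFinset = nbhd G X := by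
    ext y; simp [extNbhd, nbhd]
  rw [he] at this
  refine le_trans ?_ this
  have hx0 : (0:ℝ) ≤ X.ncard := by positivity
  have h3 : 3 ≤ 15 * (X.ncard : ℝ) / (ε * d) := by
    rw [le_div_iff₀ (by positivity)]
    nlinarith
  have hle : 15 * (X.ncard : ℝ) / (ε * d) ≤ X.ncard := by
    rw [div_le_iff₀ (by positivity)]
    nlinarith
  have hlog : 0 < Real.log (15 * X.ncard / (ε * d)) := Real.log_pos (by linarith)
  have hlog' := Real.log_le_log (by linarith) hle
  rw [div_mul_eq_mul_div]
  gcongr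

/-- Vertices reached from `X` by at most `r` steps inside `F`. -/
def ball (G : SimpleGraph V) (F X : Set V) : ℕ → Set V
  | 0 => X
  | r + 1 => ball G F X r ∪ {y | y ∈ F ∧ ∃ x ∈ ball G F X r, G.Adj x y}

theorem ball_mono (G : SimpleGraph V) (F X : Set V) : Monotone (ball G F X) :=
  monotone_nat_of_le_succ fun _ => Set.subset_union_left

theorem ball_subset (G : SimpleGraph V) (F X : Set V) (r : ℕ) : ball G F X r ⊆ X ∪ F := by
  induction r with
  | zero => exact Set.subset_union_left
  | succ r ih =>
    rintro y (hy | hy)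
    · exact ih hy
    · exact Or.inr hy.1

theorem exists_walk_of_mem_ball {G : SimpleGraph V} {F X : Set V} {r : ℕ} {y : V}
    (hy : y ∈ ball G F X r) :
    ∃ x ∈ X, ∃ w : G.Walk x y, w.length ≤ r ∧ ∀ z ∈ w.support, z = x ∨ z ∈ F := by
  induction r generalizing y with
  | zero => exact ⟨y, hy, .nil, by simp⟩
  | succ r ih =>
    rcases hy with hy | ⟨hF, z, hz, hzy⟩
    · obtain ⟨x, hx, w, hw, h⟩ := ih hy
      exact ⟨x, hx, w, by omega, h⟩
    · obtain ⟨x, hx, w, hw, h⟩ := ih hz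
      refine ⟨x, hx, w.concat hzy, by simp [Walk.length_concat]; omega, ?_⟩
      intro v hv
      rw [Walk.support_concat] at hv
      simp only [List.mem_append, List.mem_singleton] at hv
      rcases hv with hv | hv
      · exact h v hv
      · exact Or.inr (hv ▸ hF)

theorem mem_ball_of_walk {G : SimpleGraph V} {F X : Set V} {x y : V} (w : G.Walk x y)
    (hx : x ∈ X) (h : ∀ z ∈ w.support, z = x ∨ z ∈ F) {r : ℕ} (hr : w.length ≤ r) :
    y ∈ ball G F X r := by
  refine ball_mono G F X hr ?_
  clear hr
  induction w using Walk.concatRec with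
  | Hnil => exact hx
  | Hconcat p hadj ih =>
    rename_i a b c
    rw [Walk.length_concat]
    have hp := ih hx (fun z hz => h z (by rw [Walk.support_concat]; simp [hz]))
    rcases h c (by simp) with h | h
    · subst h
      exact ball_mono G F X (Nat.zero_le _) hx
    · exact Or.inr ⟨h, _, hp, hadj⟩

theorem nbhd_ball_subset (G : SimpleGraph V) (F X : Set V) (r : ℕ) :
    nbhd G (ball G F X r) ∩ F ⊆ ball G F X (r + 1) \ ball G F X r :=
  fun _ hy => ⟨Or.inr ⟨hy.2, hy.1.2⟩, hy.1.1⟩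

theorem ncard_ball_succ [Finite V] (G : SimpleGraph V) (F X : Set V) (r : ℕ) :
    (ball G F X r).ncard + (nbhd G (ball G F X r)).ncard ≤
      (ball G F X (r + 1)).ncard + (nbhd G (ball G F X r) \ F).ncard := by
  have h1 := Set.ncard_inter_add_ncard_sdiff_eq_ncard (nbhd G (ball G F X r)) F
  have h2 := Set.ncard_le_ncard (nbhd_ball_subset G F X r)
  have h3 := Set.ncard_sdiff_add_ncard_of_subset (ball_mono G F X (Nat.le_succ r))
  simp only [Nat.succ_eq_add_one] at h3
  omega

theorem one_add_pow_ge_exp {δ : ℝ} (h0 : 0 ≤ δ) (h1 : δ ≤ 1) (r : ℕ) :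
    Real.exp (r * δ / 2) ≤ (1 + δ) ^ r := by
  have : Real.exp (δ / 2) ≤ 1 + δ := by
    have h := Real.add_one_le_exp (-(δ / 2))
    rw [Real.exp_neg] at h
    have hpos := Real.exp_pos (δ / 2)
    have : (1 - δ / 2) * Real.exp (δ / 2) ≤ 1 := by
      have := mul_le_mul_of_nonneg_right h hpos.le
      rw [inv_mul_cancel₀ hpos.ne'] at this
      linarith
    nlinarith [mul_nonneg h0 (sub_nonneg.2 h1)]
  calc Real.exp (r * δ / 2) = Real.exp (δ / 2) ^ r := by rw [← Real.exp_nat_mul]; ring_nf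
    _ ≤ _ := by gcongr

/-- Balls around large sets reach more than half of an expander, avoiding a small set. -/
theorem ball_gt_half [Fintype V] {G : SimpleGraph V} {ε K ℓ : ℝ} (hG : Expands G ε K)
    (hε : 0 < ε) (hε1 : ε < 1) (hℓ : ℓ = Real.log (Fintype.card V)) (hℓε : 2 ≤ ε * ℓ)
    {F X : Set V} (hXK : K ≤ X.ncard) (hX : ℓ ^ 15 ≤ X.ncard) (hF : (Fᶜ.ncard : ℝ) ≤ ℓ ^ 12)
    {r : ℕ} (hr : 4 * ℓ ^ 3 / ε ≤ r) : (Fintype.card V : ℝ) / 2 < (ball G F X r).ncard := by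
  by_contra! hcon
  have hℓ2 : 2 < ℓ := by nlinarith
  have hn : 0 < (Fintype.card V : ℝ) := by
    rcases Nat.eq_zero_or_pos (Fintype.card V) with h | h
    · rw [h] at hℓ; simp at hℓ; linarith
    · exact_mod_cast h
  -- Half of the expansion rate ε / ℓ²: the other half pays for the vertices outside `F`, since ℓ^12
  -- ≤ δ ℓ^15. With r ≥ 4ℓ³/ε steps, (1 + δ)^r ≥ exp(rδ/2) ≥ n.
  set δ := ε / (2 * ℓ ^ 2) with hδ
  have hδ0 : 0 < δ := by positivity
  have hδ1 : δ ≤ 1 := by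
    rw [hδ, div_le_one (by positivity)]; nlinarith
  have key : ∀ i ≤ r, (1 + δ) ^ i ≤ (ball G F X i).ncard := by
    intro i
    induction i with
    | zero =>
      intro _
      have : (1:ℝ) ≤ ℓ ^ 15 := one_le_pow₀ (by linarith)
      simpa [ball] using this.trans hX
    | succ i ih =>
      intro hi
      have ih := ih (by omega)
      set x := (ball G F X i).ncard with hx
      have hmono0 : X.ncard ≤ x := Set.ncard_le_ncard (ball_mono G F X (Nat.zero_le i))
      have hmono1 : x ≤ (ball G F X r).ncard :=
        Set.ncard_le_ncard (ball_mono G F X (by omega))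
      have hmono0' : (X.ncard : ℝ) ≤ x := by exact_mod_cast hmono0
      have hmono1' : (x : ℝ) ≤ (ball G F X r).ncard := by exact_mod_cast hmono1
      have hexp := hG (ball G F X i) (by linarith) (by linarith)
      rw [← hx] at hexp
      have hxbig : ℓ ^ 15 ≤ (x:ℝ) := hX.trans hmono0'
      have hx1 : (1:ℝ) < x := lt_of_lt_of_le (one_lt_pow₀ (by linarith) (by norm_num)) hxbig
      have hlog : Real.log x ≤ ℓ := by
        rw [hℓ]
        exact Real.log_le_log (by linarith) (by linarith)
      have hlogpos : 0 < Real.log x := Real.log_pos hx1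
      have h1 : 2 * δ * x ≤ ε * x / Real.log x ^ 2 := by
        rw [hδ, show 2 * (ε / (2 * ℓ ^ 2)) * (x:ℝ) = ε * x / ℓ ^ 2 by field_simp]
        gcongr
      have h2 : ℓ ^ 12 ≤ δ * x := by
        have : δ * ℓ ^ 15 ≤ δ * x := by gcongr
        have e : δ * ℓ ^ 15 = ε * ℓ / 2 * ℓ ^ 12 := by rw [hδ]; field_simp
        have : 1 * ℓ ^ 12 ≤ ε * ℓ / 2 * ℓ ^ 12 := by gcongr; linarith
        linarith
      have h3 : ((nbhd G (ball G F X i) \ F).ncard : ℝ) ≤ ℓ ^ 12 := by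
        refine le_trans ?_ hF
        exact_mod_cast Set.ncard_le_ncard
          (show nbhd G (ball G F X i) \ F ⊆ Fᶜ from fun y hy => hy.2)
      have h4 : (x : ℝ) + (nbhd G (ball G F X i)).ncard ≤
          (ball G F X (i + 1)).ncard + (nbhd G (ball G F X i) \ F).ncard := by
        exact_mod_cast ncard_ball_succ G F X i
      calc (1 + δ) ^ (i + 1) = (1 + δ) ^ i * (1 + δ) := pow_succ _ _
        _ ≤ x * (1 + δ) := by gcongr
        _ ≤ _ := by linarith
  have h5 := (one_add_pow_ge_exp hδ0.le hδ1 r).trans (key r le_rfl)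
  have h6 : ℓ ≤ r * δ / 2 := by
    have : 4 * ℓ ^ 3 / ε * δ / 2 ≤ r * δ / 2 := by gcongr
    have e : 4 * ℓ ^ 3 / ε * δ / 2 = ℓ := by rw [hδ]; field_simp; ring
    linarith
  have h7 : (Fintype.card V : ℝ) ≤ Real.exp (r * δ / 2) := by
    rw [← Real.exp_log hn, ← hℓ]
    exact Real.exp_le_exp.2 h6
  linarith

/-- Two large sets are joined by a short walk avoiding a small set. -/
theorem exists_short_walk [Fintype V] {G : SimpleGraph V} {ε K ℓ : ℝ} (hG : Expands G ε K)
    (hε : 0 < ε) (hε1 : ε < 1) (hℓ : ℓ = Real.log (Fintype.card V)) (hℓε : 2 ≤ ε * ℓ)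
    {F X Y : Set V} (hXK : K ≤ X.ncard) (hX : ℓ ^ 15 ≤ X.ncard) (hXF : X ⊆ F)
    (hYK : K ≤ Y.ncard) (hY : ℓ ^ 15 ≤ Y.ncard) (hYF : Y ⊆ F)
    (hF : (Fᶜ.ncard : ℝ) ≤ ℓ ^ 12) :
    ∃ x ∈ X, ∃ y ∈ Y, ∃ w : G.Walk x y, w.length ≤ 2 * ⌈4 * ℓ ^ 3 / ε⌉₊ ∧
      ∀ z ∈ w.support, z ∈ F := by
  have h1 := ball_gt_half hG hε hε1 hℓ hℓε hXK hX hF (Nat.le_ceil _)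
  have h2 := ball_gt_half hG hε hε1 hℓ hℓε hYK hY hF (Nat.le_ceil _)
  set r := ⌈4 * ℓ ^ 3 / ε⌉₊
  have : ¬ Disjoint (ball G F X r) (ball G F Y r) := by
    intro hd
    have h3 := Set.ncard_union_eq hd
    have h4 : (ball G F X r ∪ ball G F Y r).ncard ≤ Fintype.card V := by
      rw [← Nat.card_eq_fintype_card]; exact Set.ncard_le_card _
    have : ((ball G F X r).ncard : ℝ) + (ball G F Y r).ncard ≤ Fintype.card V := by
      exact_mod_cast h3 ▸ h4
    linarith
  obtain ⟨z, hz1, hz2⟩ := Set.not_disjoint_iff.1 this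
  obtain ⟨x, hx, p, hp, hpF⟩ := exists_walk_of_mem_ball hz1
  obtain ⟨y, hy, q, hq, hqF⟩ := exists_walk_of_mem_ball hz2
  refine ⟨x, hx, y, hy, p.append q.reverse, by simp; omega, ?_⟩
  intro v hv
  rw [Walk.mem_support_append_iff, Walk.support_reverse, List.mem_reverse] at hv
  rcases hv with hv | hv
  · rcases hpF v hv with rfl | h
    exacts [hXF hx, h]
  · rcases hqF v hv with rfl | h
    exacts [hYF hy, h]

end KrakenLemma

/-! ### Girth: unique short paths, tree-like growth, a shortest cycle -/

namespace KrakenLemma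

variable {V : Type*}

/-- Two paths with common ends whose total length is below the girth coincide. -/
theorem path_unique_of_short {G : SimpleGraph V} {g : ℕ}
    (hg : ∀ (a : V) (c : G.Walk a a), c.IsCycle → g ≤ c.length) {x y : V} {p q : G.Walk x y}
    (hp : p.IsPath) (hq : q.IsPath) (h : p.length + q.length < g) : p = q := by
  classical
  -- If the paths differ, the union of their edges is not a forest, and a cycle in it has at most
  -- `p.length + q.length` edges.
  let H : SimpleGraph V := SimpleGraph.fromEdgeSet {e | e ∈ p.edges ∨ e ∈ q.edges}
  have hnd : ∀ e ∈ G.edgeSet, ¬ e.IsDiag := fun e he => G.not_isDiag_of_mem_edgeSet he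
  have hpH : ∀ e ∈ p.edges, e ∈ H.edgeSet := fun e he => by
    simp only [H, SimpleGraph.edgeSet_fromEdgeSet]
    exact ⟨Or.inl he, hnd e (p.edges_subset_edgeSet he)⟩
  have hqH : ∀ e ∈ q.edges, e ∈ H.edgeSet := fun e he => by
    simp only [H, SimpleGraph.edgeSet_fromEdgeSet]
    exact ⟨Or.inr he, hnd e (q.edges_subset_edgeSet he)⟩
  by_contra hne
  have hna : ¬ H.IsAcyclic := by
    intro hac
    have := congrArg Subtype.val ((hac.subsingleton_path x y).elim
      ⟨p.transfer H hpH, hp.transfer hpH⟩ ⟨q.transfer H hqH, hq.transfer hqH⟩)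
    have h2 := congrArg Walk.support this
    simp only [Walk.support_transfer] at h2
    exact hne (Walk.ext_support h2)
  unfold SimpleGraph.IsAcyclic at hna
  push Not at hna
  obtain ⟨a, c, hc⟩ := hna
  have hcG : ∀ e ∈ c.edges, e ∈ p.edges ++ q.edges := fun e he => by
    have := c.edges_subset_edgeSet he
    simp only [H, SimpleGraph.edgeSet_fromEdgeSet] at this
    exact List.mem_append.2 this.1
  have hcG' : ∀ e ∈ c.edges, e ∈ G.edgeSet := fun e he => by
    rcases List.mem_append.1 (hcG e he) with h | h
    exacts [p.edges_subset_edgeSet h, q.edges_subset_edgeSet h]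
  have h1 := hg a (c.transfer G hcG') (hc.transfer hcG')
  have h2 := (List.subperm_of_subset hc.edges_nodup hcG).length_le
  simp only [List.length_append, Walk.length_edges] at h2
  rw [Walk.length_transfer] at h1
  omega

/-- End vertices of the paths of length `r` from `v` inside `F`. -/
def treeLayer (G : SimpleGraph V) (F : Set V) (v : V) (r : ℕ) : Set V :=
  {x | ∃ p : G.Walk v x, p.IsPath ∧ p.length = r ∧ ∀ z ∈ p.support, z = v ∨ z ∈ F}

/-- Below half the girth the paths from v form a tree. Each end has at least D - 1 neighbours other
than its predecessor, stepping to one cannot return to the path, and different ends have disjoint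
sets of children; all this is uniqueness of short paths. -/
theorem mul_ncard_treeLayer_le [Finite V] {G : SimpleGraph V} {g D r : ℕ} {F : Set V} {v : V}
    (hg : ∀ (a : V) (c : G.Walk a a), c.IsCycle → g ≤ c.length)
    (hD : ∀ x, D ≤ (G.neighborSet x).ncard) (hr1 : 1 ≤ r) (hr : 2 * (r + 1) < g)
    (hfree : ∀ x y (p : G.Walk v x) (h : G.Adj x y), p.IsPath → p.length = r →
      (∀ z ∈ p.support, z = v ∨ z ∈ F) → (p.concat h).IsPath → y ∈ F) :
    (D - 1) * (treeLayer G F v r).ncard ≤ (treeLayer G F v (r + 1)).ncard := by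
  classical
  have := Fintype.ofFinite V
  let S := (treeLayer G F v r).toFinset
  have hS : ∀ x ∈ S, ∃ a, ∃ p : G.Walk v x, p.penultimate = a ∧ p.IsPath ∧ p.length = r ∧
      ∀ z ∈ p.support, z = v ∨ z ∈ F := fun x hx => by
    obtain ⟨p, hp⟩ := Set.mem_toFinset.1 hx
    exact ⟨_, p, rfl, hp⟩
  choose! pen hp using hS
  let Ch : V → Finset V := fun x => (G.neighborSet x \ {pen x}).toFinset
  have hconc : ∀ x ∈ S, ∀ y ∈ Ch x, ∃ (p : G.Walk v x) (h : G.Adj x y), p.penultimate = pen x ∧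
      p.IsPath ∧ p.length = r ∧ (∀ z ∈ p.support, z = v ∨ z ∈ F) ∧ (p.concat h).IsPath := by
    intro x hx y hy
    obtain ⟨p, hpen, hpath, hlen, hF⟩ := hp x hx
    have hadj : G.Adj x y ∧ y ≠ pen x := by simpa [Ch] using hy
    refine ⟨p, hadj.1, hpen, hpath, hlen, hF, hpath.concat (fun hys => ?_) hadj.1⟩
    have hl := p.length_dropUntil_le_length hys
    have he : p.dropUntil y hys = hadj.1.symm.toWalk :=
      path_unique_of_short hg (hpath.dropUntil hys) (by simp [hadj.1.ne']) (by
        simp only [Walk.length_cons, Walk.length_nil, SimpleGraph.Adj.toWalk]; omega)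
    have h2 := p.take_spec hys
    rw [he] at h2
    apply hadj.2
    rw [← hpen, ← h2]
    exact (Walk.penultimate_concat _ hadj.1.symm).symm
  have hsub : S.biUnion Ch ⊆ (treeLayer G F v (r + 1)).toFinset := by
    intro y hy
    obtain ⟨x, hx, hy⟩ := Finset.mem_biUnion.1 hy
    obtain ⟨p, h, -, h1, h2, h3, hpath⟩ := hconc x hx y hy
    have hyF := hfree x y p h h1 h2 h3 hpath
    rw [Set.mem_toFinset]
    refine ⟨_, hpath, by simp [Walk.length_concat, h2], ?_⟩
    intro z hz
    rw [Walk.support_concat] at hz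
    simp only [List.mem_append, List.mem_singleton] at hz
    rcases hz with hz | rfl
    exacts [h3 z hz, Or.inr hyF]
  have hdisj : (S : Set V).PairwiseDisjoint Ch := by
    intro x hx x' hx' hne
    rw [Function.onFun, Finset.disjoint_left]
    intro y hy hy'
    obtain ⟨p, h, h1, -, h2, -, hpath⟩ := hconc x hx y hy
    obtain ⟨p', h', h1', -, h2', -, hpath'⟩ := hconc x' hx' y hy'
    have := path_unique_of_short hg hpath hpath' (by
      rw [Walk.length_concat, Walk.length_concat, h2, h2']; omega)
    have := congrArg Walk.penultimate this
    rw [Walk.penultimate_concat, Walk.penultimate_concat] at this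
    exact hne this
  have hcard : ∀ x ∈ S, D - 1 ≤ (Ch x).card := by
    intro x _
    simp only [Ch, ← Set.ncard_eq_toFinset_card']
    have := Set.le_ncard_sdiff {pen x} (G.neighborSet x)
    rw [Set.ncard_singleton] at this
    have := hD x
    omega
  have h1 := Finset.card_le_card hsub
  rw [Finset.card_biUnion hdisj] at h1
  have h2 := Finset.card_nsmul_le_sum S _ _ hcard
  rw [smul_eq_mul, mul_comm] at h2
  rw [Set.ncard_eq_toFinset_card' (treeLayer G F v r), Set.ncard_eq_toFinset_card']
  exact h2.trans h1

/-- The first step is only asked to be possible, so layer R + 1 has exponent R. This suits a root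
most of whose neighbours may be blocked. -/
theorem pow_le_ncard_treeLayer [Finite V] {G : SimpleGraph V} {g D R : ℕ} {F : Set V} {v : V}
    (hg : ∀ (a : V) (c : G.Walk a a), c.IsCycle → g ≤ c.length)
    (hD : ∀ x, D ≤ (G.neighborSet x).ncard) (hR : 2 * (R + 1) < g)
    (h1 : (treeLayer G F v 1).Nonempty)
    (hfree : ∀ r, 1 ≤ r → r ≤ R → ∀ x y (p : G.Walk v x) (h : G.Adj x y), p.IsPath →
      p.length = r →
      (∀ z ∈ p.support, z = v ∨ z ∈ F) → (p.concat h).IsPath → y ∈ F) :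
    (D - 1) ^ R ≤ (treeLayer G F v (R + 1)).ncard := by
  induction R with
  | zero => simpa using Nat.succ_le_of_lt ((Set.ncard_pos).2 h1)
  | succ R ih =>
    have h2 := ih (by omega) (fun r h h' => hfree r h (by omega))
    have h3 := mul_ncard_treeLayer_le (r := R + 1) hg hD (by omega) (by omega)
      (hfree (R + 1) (by omega) le_rfl)
    calc (D - 1) ^ (R + 1) = (D - 1) * (D - 1) ^ R := pow_succ' _ _
      _ ≤ _ := (Nat.mul_le_mul_left _ h2).trans h3

theorem treeLayer_one_nonempty {G : SimpleGraph V} {F : Set V} {v y : V} (h : G.Adj v y)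
    (hy : y ∈ F) : (treeLayer G F v 1).Nonempty :=
  ⟨y, h.toWalk, by simp [h.ne], by simp, by simp [hy]⟩

theorem treeLayer_subset_ball {G : SimpleGraph V} {F : Set V} {v : V} (r : ℕ) :
    treeLayer G F v (r + 1) ⊆ ball G F (G.neighborSet v ∩ F) r := by
  rintro x ⟨p, hp, hlen, hF⟩
  cases p with
  | nil => simp at hlen
  | cons h q =>
    rename_i a
    rw [Walk.cons_isPath_iff] at hp
    have hq : ∀ z ∈ q.support, z ∈ F := fun z hz => by
      rcases hF z (by simp [hz]) with rfl | h
      exacts [absurd hz hp.2, h]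
    exact mem_ball_of_walk q (show a ∈ G.neighborSet v ∩ F from ⟨h, hq _ q.start_mem_support⟩) (fun z hz => Or.inr (hq z hz))
      (by simpa using hlen.le)

/-- Graphs of minimum degree `D` have a cycle of length at most `2 * R + 2` when
`(D - 1) ^ R` exceeds the number of vertices. -/
theorem exists_shortest_cycle [Fintype V] [Nonempty V] {G : SimpleGraph V} {D R : ℕ}
    (hD : ∀ x, D ≤ (G.neighborSet x).ncard) (hD1 : 1 ≤ D)
    (hR : Fintype.card V < (D - 1) ^ R) :
    ∃ k, 3 ≤ k ∧ k ≤ 2 * R + 2 ∧ (∀ (a : V) (c : G.Walk a a), c.IsCycle → k ≤ c.length) ∧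
      Nonempty (Copy (cycleGraph k) G) := by
  classical
  have key : ∃ (a : V) (c : G.Walk a a), c.IsCycle ∧ c.length ≤ 2 * R + 2 := by
    by_contra! hcon
    obtain ⟨v⟩ := ‹Nonempty V›
    have hne : (G.neighborSet v).Nonempty := by
      rw [← Set.ncard_pos]
      have := hD v
      omega
    obtain ⟨y, hy⟩ := hne
    -- Without a cycle of length at most 2R + 2 the tree growth would exceed the number of vertices.
    have := pow_le_ncard_treeLayer (F := Set.univ) (v := v) (R := R) (g := 2 * R + 3)
      (fun a c hc => hcon a c hc) hD (by omega) (treeLayer_one_nonempty hy trivial)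
      (by simp)
    have h2 := Set.ncard_le_card (treeLayer G Set.univ v (R + 1))
    rw [Nat.card_eq_fintype_card] at h2
    omega
  have hna : ¬ G.IsAcyclic := by
    obtain ⟨a, c, hc, -⟩ := key
    exact fun h => h c hc
  obtain ⟨a, c, hc, hlen⟩ := SimpleGraph.exists_girth_eq_length.2 hna
  have h3 := SimpleGraph.three_le_girth hna
  refine ⟨G.girth, h3, ?_, fun b c hc => SimpleGraph.girth_le_length hc, ?_⟩
  · obtain ⟨b, c', hc', hl⟩ := key
    exact (SimpleGraph.girth_le_length hc').trans hl
  · exact (SimpleGraph.cycleGraph_isContained_iff (by omega)).2 ⟨a, c, hc, hlen.symm⟩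

/-- The shorter arc between two vertices of a cycle. -/
theorem exists_cycleGraph_path {k : ℕ} (hk : 3 ≤ k) (i j : Fin k) :
    ∃ w : (cycleGraph k).Walk i j, w.IsPath ∧ w.length ≤ k / 2 := by
  classical
  obtain ⟨n, rfl⟩ : ∃ n, k = n + 2 := ⟨k - 2, by omega⟩
  have hsucc : ∀ (i : Fin (n + 2)), (cycleGraph (n + 2)).Adj i (i + 1) := fun i => by
    rw [cycleGraph_adj]; right; simp
  have hw : ∀ (t : ℕ) (i j : Fin (n + 2)), j.val = (i.val + t) % (n + 2) →
      ∃ w : (cycleGraph (n + 2)).Walk i j, w.length = t := by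
    intro t
    induction t with
    | zero =>
      intro i j h
      have : i = j := Fin.ext (by rw [h, add_zero, Nat.mod_eq_of_lt i.2])
      exact ⟨Walk.nil.copy rfl this, by simp⟩
    | succ t ih =>
      intro i j h
      obtain ⟨w, hw⟩ := ih i ⟨(i.val + t) % (n + 2), Nat.mod_lt _ (by omega)⟩ rfl
      have hj : ⟨(i.val + t) % (n + 2), Nat.mod_lt _ (by omega)⟩ + 1 = j := Fin.ext (by
        rw [h, Fin.val_add]; simp [add_assoc])
      exact ⟨(w.concat (hsucc _)).copy rfl hj, by simp [Walk.length_concat, hw]⟩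
  have key : ∃ w : (cycleGraph (n + 2)).Walk i j, w.length ≤ (n + 2) / 2 := by
    obtain ⟨w1, h1⟩ := hw (j - i).val i j (by rw [← Fin.val_add]; simp)
    obtain ⟨w2, h2⟩ := hw (i - j).val j i (by rw [← Fin.val_add]; simp)
    have hsum : (j - i).val + (i - j).val ≤ n + 2 := by
      rcases lt_trichotomy i j with h | h | h
      · rw [Fin.sub_val_of_le h.le, Fin.coe_sub_iff_lt.2 h]
        have := i.2; have := j.2; have : i.val < j.val := h; omega
      · simp [h]
      · rw [Fin.sub_val_of_le h.le, Fin.coe_sub_iff_lt.2 h]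
        have := i.2; have := j.2; have : j.val < i.val := h; omega
    by_cases hle : (j - i).val ≤ (i - j).val
    · exact ⟨w1, by omega⟩
    · exact ⟨w2.reverse, by rw [Walk.length_reverse]; omega⟩
  obtain ⟨w, hw⟩ := key
  exact ⟨w.bypass, w.bypass_isPath, w.length_bypass_le_length.trans hw⟩

/-- In a copy of a cycle, paths along the shorter arc. -/
theorem exists_cycle_arc {G : SimpleGraph V} {k : ℕ} (hk : 3 ≤ k)
    (C : Copy (cycleGraph k) G) (i j : Fin k) :
    ∃ w : G.Walk (C i) (C j), w.IsPath ∧ w.length ≤ k / 2 ∧ (∀ z ∈ w.support, z ∈ Set.range C) ∧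
      (w.length = 1 → (cycleGraph k).Adj i j) := by
  obtain ⟨w, hp, hw⟩ := exists_cycleGraph_path hk i j
  refine ⟨w.map C.toHom, hp.map C.injective,
    by rw [Walk.length_map]; exact hw, ?_, ?_⟩
  · intro z hz
    rw [Walk.support_map] at hz
    obtain ⟨a, -, ha⟩ := List.mem_map.1 hz
    exact ⟨a, ha⟩
  · intro h
    rw [Walk.length_map] at h
    exact Walk.adj_of_length_eq_one h

end KrakenLemma

/-! ### Linking problems and partial solutions of minimal cost -/

namespace KrakenLemma

variable {V : Type*} {I : Type*}

/-- A walk, bundled with its ends. -/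
structure Arm (G : SimpleGraph V) where
  fst : V
  lst : V
  walk : G.Walk fst lst

/-- The vertices of an arm. -/
def Arm.verts {G : SimpleGraph V} (b : Arm G) : Set V := {x | x ∈ b.walk.support}

/-- A linking problem: the vertices `start e` are to be joined to targets in `T` with distinct
labels by disjoint walks of length at most `M` avoiding `core`. -/
structure Frame (V I : Type*) where
  core : Set V
  T : Set V
  lab : V → V
  M : ℕ
  start : I → V

/-- The walk `b` serves the vertex `v`. -/
structure Frame.IsArm (Φ : Frame V I) {G : SimpleGraph V} (v : V) (b : Arm G) : Prop where
  -- The walk starts at a neighbour of v and leaves v out, so the two arms at one cycle vertex can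
  -- be required to be disjoint.
  adj : G.Adj v b.fst
  avoid : ∀ z ∈ b.verts, z ∉ Φ.core
  lst_mem : b.lst ∈ Φ.T
  -- Arms meet targets only at their ends, so no arm runs through the cell of another.
  eq_lst : ∀ z ∈ b.verts, z ∈ Φ.T → z = b.lst
  length_le : b.walk.length + 1 ≤ Φ.M

/-- A partial solution of the linking problem. -/
structure Frame.IsFamily (Φ : Frame V I) {G : SimpleGraph V} (F : I → Option (Arm G)) : Prop where
  isArm : ∀ e b, F e = some b → Φ.IsArm (Φ.start e) b
  disj : ∀ e e' b b', e ≠ e' → F e = some b → F e' = some b' →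
    Disjoint b.verts b'.verts ∧ Φ.lab b.lst ≠ Φ.lab b'.lst

/-- The vertices on the arms of a partial solution. -/
def occupied {G : SimpleGraph V} (F : I → Option (Arm G)) : Set V :=
  {x | ∃ e b, F e = some b ∧ x ∈ b.verts}

/-- The labels used by a partial solution. -/
def Frame.usedLab (Φ : Frame V I) {G : SimpleGraph V} (F : I → Option (Arm G)) : Set V :=
  {a | ∃ e b, F e = some b ∧ Φ.lab b.lst = a}

/-- The vertices away from the core, the arms and the targets. -/
def Frame.free (Φ : Frame V I) {G : SimpleGraph V} (F : I → Option (Arm G)) : Set V :=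
  (Φ.core ∪ occupied F ∪ Φ.T)ᶜ

/-- The length of an arm; a missing arm is counted as longer than all arms. -/
def Frame.weight (Φ : Frame V I) {G : SimpleGraph V} : Option (Arm G) → ℕ
  | none => Φ.M
  | some b => b.walk.length

/-- The total length of a partial solution. -/
def Frame.cost (Φ : Frame V I) [Fintype I] {G : SimpleGraph V} (F : I → Option (Arm G)) : ℕ :=
  ∑ e, Φ.weight (F e)

/-- A partial solution of minimal cost. -/
def Frame.IsOptimal (Φ : Frame V I) [Fintype I] {G : SimpleGraph V} (F : I → Option (Arm G)) :
    Prop :=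
  Φ.IsFamily F ∧ ∀ F' : I → Option (Arm G), Φ.IsFamily F' → Φ.cost F ≤ Φ.cost F'

theorem Frame.exists_isOptimal (Φ : Frame V I) [Fintype I] (G : SimpleGraph V) :
    ∃ F : I → Option (Arm G), Φ.IsOptimal F := by
  have h : ∃ n, ∃ F : I → Option (Arm G), Φ.IsFamily F ∧ Φ.cost F = n :=
    ⟨_, fun _ => none, ⟨by simp, by simp⟩, rfl⟩
  classical
  obtain ⟨F, hF, hc⟩ := Nat.find_spec h
  exact ⟨F, hF, fun F' hF' => hc ▸ Nat.find_min' h ⟨F', hF', rfl⟩⟩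

theorem Frame.cost_update (Φ : Frame V I) [Fintype I] [DecidableEq I] {G : SimpleGraph V}
    (F : I → Option (Arm G)) (e : I) (x : Option (Arm G)) :
    Φ.cost (Function.update F e x) + Φ.weight (F e) = Φ.cost F + Φ.weight x := by
  unfold Frame.cost
  rw [← Finset.add_sum_erase _ _ (Finset.mem_univ e), ← Finset.add_sum_erase (a := e) _
    (fun e => Φ.weight (F e)) (Finset.mem_univ e), Function.update_self]
  rw [Finset.sum_congr rfl (g := fun i => Φ.weight (F i)) (fun i hi => by
    rw [Function.update_of_ne (Finset.ne_of_mem_erase hi)])]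
  ring

theorem Frame.IsFamily.erase {Φ : Frame V I} [DecidableEq I] {G : SimpleGraph V}
    {F : I → Option (Arm G)} (h : Φ.IsFamily F) (e : I) :
    Φ.IsFamily (Function.update F e none) := by
  have key : ∀ e' b, Function.update F e none e' = some b → F e' = some b := by
    intro e' b hb
    by_cases he : e' = e
    · subst he; simp at hb
    · rwa [Function.update_of_ne he] at hb
  exact ⟨fun e' b hb => h.isArm e' b (key e' b hb),
    fun e₁ e₂ b b' hne hb hb' => h.disj e₁ e₂ b b' hne (key _ _ hb) (key _ _ hb')⟩

theorem Frame.IsFamily.update {Φ : Frame V I} [DecidableEq I] {G : SimpleGraph V}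
    {F : I → Option (Arm G)} (h : Φ.IsFamily F) {e : I} {b : Arm G}
    (hb : Φ.IsArm (Φ.start e) b)
    (hd : ∀ e' b', e' ≠ e → F e' = some b' →
      Disjoint b.verts b'.verts ∧ Φ.lab b.lst ≠ Φ.lab b'.lst) :
    Φ.IsFamily (Function.update F e (some b)) := by
  have key : ∀ e' b', Function.update F e (some b) e' = some b' →
      (e' = e ∧ b' = b) ∨ (e' ≠ e ∧ F e' = some b') := by
    intro e' b' hb
    by_cases he : e' = e
    · subst he; simp at hb; exact Or.inl ⟨rfl, hb.symm⟩
    · rw [Function.update_of_ne he] at hb; exact Or.inr ⟨he, hb⟩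
  refine ⟨fun e' b' hb' => ?_, fun e₁ e₂ b₁ b₂ hne h₁ h₂ => ?_⟩
  · rcases key e' b' hb' with ⟨rfl, rfl⟩ | ⟨-, h'⟩
    exacts [hb, h.isArm _ _ h']
  · rcases key _ _ h₁ with ⟨rfl, rfl⟩ | ⟨hn₁, k₁⟩ <;> rcases key _ _ h₂ with ⟨rfl, rfl⟩ | ⟨hn₂, k₂⟩
    · exact absurd rfl hne
    · exact hd _ _ hn₂ k₂
    · have := hd _ _ hn₁ k₁
      exact ⟨this.1.symm, this.2.symm⟩
    · exact h.disj _ _ _ _ hne k₁ k₂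

section Optimal

variable {Φ : Frame V I} [Fintype I] {G : SimpleGraph V} {F : I → Option (Arm G)}

/-- Adding an arm lowers the cost, because a missing arm is charged M and an arm has length below M.
A walk that passes several targets is first cut at an earlier one. -/
theorem Frame.IsOptimal.no_extension (h : Φ.IsOptimal F) {e : I} (he : F e = none) {a t : V}
    (hadj : G.Adj (Φ.start e) a) (p : G.Walk a t) (ht : t ∈ Φ.T)
    (havoid : ∀ z ∈ p.support, z ∉ Φ.core ∪ occupied F)
    (hlab : ∀ z ∈ p.support, z ∈ Φ.T → Φ.lab z ∉ Φ.usedLab F)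
    (hlen : p.length + 1 ≤ Φ.M) : False := by
  classical
  induction hn : p.length using Nat.strong_induction_on generalizing t with
  | _ n ih =>
    by_cases hex : ∃ z ∈ p.support, z ∈ Φ.T ∧ z ≠ t
    · obtain ⟨z, hz, hzT, hne⟩ := hex
      have hlt := Walk.length_takeUntil_lt_length hz hne
      exact ih _ (hn ▸ hlt) (p.takeUntil z hz) hzT
        (fun y hy => havoid y (p.support_takeUntil_subset_support hz hy))
        (fun y hy => hlab y (p.support_takeUntil_subset_support hz hy)) (by omega) rfl
    · push Not at hex
      have hb : Φ.IsArm (Φ.start e) ⟨a, t, p⟩ :=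
        ⟨hadj, fun z hz hc => havoid z hz (Or.inl hc), ht, hex, hlen⟩
      have := h.2 _ (h.1.update (e := e) hb (fun e' b' hne hb' =>
        ⟨Set.disjoint_left.2 fun z hz hz' => havoid z hz (Or.inr ⟨e', b', hb', hz'⟩),
          fun hl => hlab t p.end_mem_support ht ⟨e', b', hb', hl.symm⟩⟩))
      have h2 := Φ.cost_update F e (some ⟨a, t, p⟩)
      simp only [he, Frame.weight] at h2
      omega

/-- The unserved index can take over the end of `b'` through `b`, leaving `e'` unserved in its
place. The family stays valid as `b` uses only free vertices and vertices of `b'`, so minimality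
compares just the two lengths. -/
theorem Frame.IsOptimal.exchange (h : Φ.IsOptimal F) {e e' : I} (he : F e = none) {b b' : Arm G}
    (hb' : F e' = some b') (hlst : b.lst = b'.lst) (hadj : G.Adj (Φ.start e) b.fst)
    (hsub : ∀ z ∈ b.verts, z ∈ Φ.free F ∨ z ∈ b'.verts) :
    b'.walk.length ≤ b.walk.length := by
  classical
  by_contra! hlt
  have hne : e' ≠ e := by rintro rfl; simp [he] at hb'
  have hA := h.1.isArm e' b' hb'
  have hb : Φ.IsArm (Φ.start e) b := by
    refine ⟨hadj, fun z hz hc => ?_, hlst ▸ hA.lst_mem, fun z hz hT => ?_,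
      by have := hA.length_le; omega⟩
    · rcases hsub z hz with h1 | h1
      exacts [h1 (Or.inl (Or.inl hc)), hA.avoid z h1 hc]
    · rcases hsub z hz with h1 | h1
      exacts [absurd (Or.inr hT) h1, (hA.eq_lst z h1 hT).trans hlst.symm]
  have hfam : Φ.IsFamily (Function.update (Function.update F e' none) e (some b)) := by
    refine (h.1.erase e').update hb fun e₂ b₂ hne₂ hb₂ => ?_
    have hne₃ : e₂ ≠ e' := by rintro rfl; simp at hb₂
    rw [Function.update_of_ne hne₃] at hb₂
    have hd := h.1.disj _ _ _ _ hne₃.symm hb' hb₂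
    refine ⟨Set.disjoint_left.2 fun z hz hz' => ?_, hlst ▸ hd.2⟩
    rcases hsub z hz with h1 | h1
    · exact h1 (Or.inl (Or.inr ⟨e₂, b₂, hb₂, hz'⟩))
    · exact Set.disjoint_left.1 hd.1 h1 hz'
  have h1 := h.2 _ hfam
  have h2 := Φ.cost_update (Function.update F e' none) e (some b)
  have h3 := Φ.cost_update F e' none
  rw [Function.update_of_ne hne.symm, he] at h2
  rw [hb'] at h3
  simp only [Frame.weight] at h2 h3
  omega

/-- Entering the arm at y and following it to its end must not be shorter than the whole arm. -/
theorem Frame.IsOptimal.idxOf_eq_zero [DecidableEq V] (h : Φ.IsOptimal F) {e e' : I}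
    (he : F e = none) {b' : Arm G} (hb' : F e' = some b') {y : V} (hy : y ∈ b'.verts)
    (hadj : G.Adj (Φ.start e) y) : b'.walk.support.idxOf y = 0 := by
  have hx := h.exchange he hb' (b := ⟨y, b'.lst, b'.walk.dropUntil y hy⟩) rfl hadj
    (fun z hz => Or.inr (b'.walk.support_dropUntil_subset_support hy hz))
  have h1 := b'.walk.length_dropUntil hy
  have h2 := List.idxOf_lt_length_of_mem hy
  rw [Walk.length_support] at h2
  simp only at hx
  omega

/-- The same exchange after a detour through free vertices: the part of the arm cut off is no longer
than the detour. -/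
theorem Frame.IsOptimal.idxOf_le [DecidableEq V] (h : Φ.IsOptimal F) {e e' : I}
    (he : F e = none) {b' : Arm G} (hb' : F e' = some b') {a x y : V} (hy : y ∈ b'.verts)
    (hadj : G.Adj (Φ.start e) a) (p : G.Walk a x) (hp : ∀ z ∈ p.support, z ∈ Φ.free F)
    (hxy : G.Adj x y) : b'.walk.support.idxOf y ≤ p.length + 1 := by
  have hx := h.exchange he hb' (b := ⟨a, b'.lst, p.append (.cons hxy (b'.walk.dropUntil y hy))⟩)
    rfl hadj (fun z hz => by
      simp only [Arm.verts, Set.mem_ofPred_eq, Walk.mem_support_append_iff, Walk.support_cons,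
        List.mem_cons] at hz
      rcases hz with hz | rfl | hz
      exacts [Or.inl (hp z hz), Or.inl (hp _ p.end_mem_support),
        Or.inr (b'.walk.support_dropUntil_subset_support hy hz)])
  have h1 := b'.walk.length_dropUntil hy
  have h2 := List.idxOf_lt_length_of_mem hy
  rw [Walk.length_support] at h2
  simp only [Walk.length_append, Walk.length_cons] at hx
  omega

end Optimal

end KrakenLemma

/-! ### What blocks the exploration from an unserved vertex -/

namespace KrakenLemma

variable {V : Type*} {I : Type*}

/-- The initial vertices of the arms, up to index `r`. -/
def lowSet {G : SimpleGraph V} (F : I → Option (Arm G)) (r : ℕ) : Set V :=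
  {y | ∃ e b, F e = some b ∧ ∃ j ≤ r, b.walk.getVert j = y}

theorem ncard_lowSet_le [Fintype I] {G : SimpleGraph V} (F : I → Option (Arm G)) (r : ℕ) :
    (lowSet F r).ncard ≤ Fintype.card I * (r + 1) := by
  classical
  let f : I → Finset V := fun e => (F e).elim ∅ fun b => (Finset.range (r + 1)).image b.walk.getVert
  have hsub : lowSet F r ⊆ (Finset.univ.biUnion f : Finset V) := by
    rintro y ⟨e, b, hb, j, hj, rfl⟩
    simp only [Finset.coe_biUnion, Set.mem_iUnion, f]
    refine ⟨e, by simp, ?_⟩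
    rw [hb]
    simp only [Option.elim, Finset.coe_image]
    exact ⟨j, by simpa using Nat.lt_succ_of_le hj, rfl⟩
  have h1 := Set.ncard_le_ncard hsub
  rw [Set.ncard_coe_finset] at h1
  refine h1.trans ((Finset.card_biUnion_le_card_mul _ _ (r + 1) fun e _ => ?_).trans (by
    rw [Finset.card_univ]))
  simp only [f]
  cases F e with
  | none => simp
  | some b => exact Finset.card_image_le.trans (by simp)

theorem occupied_subset_lowSet [Fintype I] {G : SimpleGraph V} {Φ : Frame V I}
    {F : I → Option (Arm G)} (h : Φ.IsFamily F) : occupied F ⊆ lowSet F (Φ.M - 1) := by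
  rintro y ⟨e, b, hb, hy⟩
  obtain ⟨j, hj, hle⟩ := Walk.mem_support_iff_exists_getVert.1 hy
  have := (h.isArm e b hb).length_le
  exact ⟨e, b, hb, j, by omega, hj⟩

theorem ncard_usedLab_lt [Fintype I] {G : SimpleGraph V} {Φ : Frame V I}
    {F : I → Option (Arm G)} {e : I} (he : F e = none) :
    (Φ.usedLab F).ncard < Fintype.card I := by
  classical
  let S : Finset I := Finset.univ.filter fun e => F e ≠ none
  have hS : ∀ e ∈ S, ∃ b, F e = some b := fun e h => Option.ne_none_iff_exists'.1 (by simpa [S] using h)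
  let f : I → V := fun e => (F e).elim (Φ.lab (Φ.start e)) fun b => Φ.lab b.lst
  have hsub : Φ.usedLab F ⊆ (S.image f : Finset V) := by
    rintro a ⟨e, b, hb, rfl⟩
    rw [Finset.coe_image]
    exact ⟨e, by simp [S, hb], by simp [f, hb]⟩
  have h1 := Set.ncard_le_ncard hsub
  rw [Set.ncard_coe_finset] at h1
  have h2 : S.card < Fintype.card I := by
    rw [← Finset.card_univ]
    exact Finset.card_lt_card (Finset.filter_ssubset.2 ⟨e, by simp, by simp [he]⟩)
  exact (h1.trans Finset.card_image_le).trans_lt h2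

/-- The hypotheses on the targets: vertices of `L` outside the core are targets with their own
label, all other targets are far from the core in `G - L`. -/
structure Frame.Separated (Φ : Frame V I) (G : SimpleGraph V) (L : Set V) (ρ : ℕ) : Prop where
  start_mem : ∀ e, Φ.start e ∈ Φ.core
  disj : ∀ t ∈ Φ.T, t ∉ Φ.core
  L_sub : ∀ l ∈ L, l ∉ Φ.core → l ∈ Φ.T
  L_lab : ∀ l ∈ L, l ∈ Φ.T → ∀ t ∈ Φ.T, Φ.lab t = Φ.lab l → t = l
  far : ∀ v ∈ Φ.core, v ∉ L → ∀ t ∈ Φ.T, t ∉ L → ∀ w : G.Walk v t,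
    (∀ z ∈ w.support, z ∉ L) → ρ < w.length
  le_M : ρ ≤ Φ.M

/-- The neighbours of the start of an unserved index inside the free region. -/
def Frame.seed (Φ : Frame V I) {G : SimpleGraph V} (F : I → Option (Arm G)) (e : I) : Set V :=
  G.neighborSet (Φ.start e) ∩ Φ.free F

theorem exists_walk_of_mem_seed_ball {Φ : Frame V I} {G : SimpleGraph V}
    {F : I → Option (Arm G)} {e : I} {x : V} {r : ℕ}
    (hx : x ∈ ball G (Φ.free F) (Φ.seed F e) r) :
    ∃ a, G.Adj (Φ.start e) a ∧ ∃ p : G.Walk a x, p.length ≤ r ∧ ∀ z ∈ p.support, z ∈ Φ.free F := by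
  obtain ⟨a, ha, p, hp, hF⟩ := exists_walk_of_mem_ball hx
  refine ⟨a, ha.1, p, hp, fun z hz => ?_⟩
  rcases hF z hz with rfl | h
  exacts [ha.2, h]

section Local

variable {Φ : Frame V I} [Fintype I] {G : SimpleGraph V} {F : I → Option (Arm G)} {L : Set V}
  {ρ : ℕ}

/-- An unoccupied target in L has an unused label and would give an extension. One outside L is
excluded by distance, because free vertices avoid L: every vertex of L is a target or in the core.
-/
theorem Frame.IsOptimal.target_mem_occupied (h : Φ.IsOptimal F) (hsep : Φ.Separated G L ρ) {e : I}
    (he : F e = none) (hv : Φ.start e ∉ L) {a y : V} (hadj : G.Adj (Φ.start e) a)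
    (p : G.Walk a y) (hp : ∀ z ∈ p.support, z = y ∨ z ∈ Φ.free F) (hy : y ∈ Φ.T)
    (hlen : p.length + 1 ≤ ρ) : y ∈ occupied F := by
  by_contra hocc
  by_cases hyL : y ∈ L
  · refine h.no_extension he hadj p hy ?_ ?_ (hlen.trans hsep.le_M)
    · intro z hz
      rcases hp z hz with rfl | hz
      · rintro (hc | hc)
        exacts [hsep.disj _ hy hc, hocc hc]
      · exact fun hc => hz (Or.inl hc)
    · intro z hz hzT
      have : z = y := (hp z hz).resolve_right fun hz => hz (Or.inr hzT)
      subst this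
      rintro ⟨e', b', hb', hl⟩
      have := hsep.L_lab z hyL hzT b'.lst (h.1.isArm _ _ hb').lst_mem hl
      exact hocc ⟨e', b', hb', this ▸ b'.walk.end_mem_support⟩
  · have := hsep.far _ (hsep.start_mem e) hv y hy hyL (.cons hadj p) (by
      intro z hz
      rw [Walk.support_cons, List.mem_cons] at hz
      rcases hz with rfl | hz
      · exact hv
      · rcases hp z hz with rfl | hz
        · exact hyL
        · intro hzL
          by_cases hc : z ∈ Φ.core
          · exact hz (Or.inl (Or.inl hc))
          · exact hz (Or.inr (hsep.L_sub z hzL hc)))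
    rw [Walk.length_cons] at this
    omega

theorem Frame.IsOptimal.nbr_start (h : Φ.IsOptimal F) (hsep : Φ.Separated G L ρ) {e : I}
    (he : F e = none) (hv : Φ.start e ∉ L) (hρ : 1 ≤ ρ) {y : V} (hadj : G.Adj (Φ.start e) y)
    (hy : y ∉ Φ.free F) : y ∈ Φ.core ∨ ∃ e' b', F e' = some b' ∧ b'.fst = y := by
  classical
  have hcases : y ∈ Φ.core ∨ y ∈ occupied F := by
    simp only [Frame.free, Set.mem_compl_iff, not_not] at hy
    rcases hy with (hy | hy) | hy
    · exact Or.inl hy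
    · exact Or.inr hy
    · exact Or.inr (h.target_mem_occupied hsep he hv hadj .nil (by simp) hy (by simpa using hρ))
  rcases hcases with hy | ⟨e', b', hb', hy⟩
  · exact Or.inl hy
  · have h0 := h.idxOf_eq_zero he hb' hy hadj
    refine Or.inr ⟨e', b', hb', ?_⟩
    have := b'.walk.getVert_support_idxOf hy
    rwa [h0, Walk.getVert_zero] at this

theorem Frame.IsOptimal.mem_of_notMem_free (h : Φ.IsOptimal F) (hsep : Φ.Separated G L ρ) {e : I}
    (he : F e = none) (hv : Φ.start e ∉ L) {a x y : V} (hadj : G.Adj (Φ.start e) a)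
    (p : G.Walk a x) (hp : ∀ z ∈ p.support, z ∈ Φ.free F) (hxy : G.Adj x y)
    (hlen : p.length + 2 ≤ ρ) (hy : y ∉ Φ.free F) :
    y ∈ Φ.core ∨ ∃ e' b', F e' = some b' ∧ y ∈ b'.verts ∧ ∃ q : G.Walk b'.fst y,
      q.length ≤ p.length + 1 ∧ ∀ z ∈ q.support, z ∈ b'.verts := by
  classical
  have hcases : y ∈ Φ.core ∨ y ∈ occupied F := by
    have hy' := hy
    simp only [Frame.free, Set.mem_compl_iff, not_not] at hy
    rcases hy with (hy | hy) | hy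
    · exact Or.inl hy
    · exact Or.inr hy
    · refine Or.inr (h.target_mem_occupied hsep he hv hadj (p.concat hxy) ?_ hy
        (by rw [Walk.length_concat]; omega))
      intro z hz
      rw [Walk.support_concat] at hz
      simp only [List.mem_append, List.mem_singleton] at hz
      rcases hz with hz | rfl
      exacts [Or.inr (hp z hz), Or.inl rfl]
  rcases hcases with hy | ⟨e', b', hb', hy⟩
  · exact Or.inl hy
  · have h0 := h.idxOf_le he hb' hy hadj p hp hxy
    exact Or.inr ⟨e', b', hb', hy, b'.walk.takeUntil y hy, (Walk.length_takeUntil _ hy).trans_le h0,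
      fun z hz => b'.walk.support_takeUntil_subset_support hy hz⟩

/-- This bounds the loss at radius r by a quantity linear in r, instead of the total length of all
arms. -/
theorem Frame.IsOptimal.nbhd_ball_diff_subset (h : Φ.IsOptimal F) (hsep : Φ.Separated G L ρ)
    {e : I} (he : F e = none) (hv : Φ.start e ∉ L) {r : ℕ} (hr : r + 2 ≤ ρ) :
    nbhd G (ball G (Φ.free F) (Φ.seed F e) r) \ Φ.free F ⊆ Φ.core ∪ lowSet F (r + 1) := by
  classical
  rintro y ⟨⟨-, x, hx, hxy⟩, hy⟩
  obtain ⟨a, hadj, p, hp, hF⟩ := exists_walk_of_mem_seed_ball hx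
  have := h.mem_of_notMem_free hsep he hv hadj p hF hxy (by omega) hy
  rcases this with h1 | ⟨e', b', hb', hyb, -⟩
  · exact Or.inl h1
  · have h0 := h.idxOf_le he hb' hyb hadj p hF hxy
    exact Or.inr ⟨e', b', hb', _, by omega, b'.walk.getVert_support_idxOf hyb⟩

theorem Frame.IsOptimal.ncard_ball_succ_ge [Finite V] (h : Φ.IsOptimal F)
    (hsep : Φ.Separated G L ρ)
    {e : I} (he : F e = none) (hv : Φ.start e ∉ L) {r : ℕ} (hr : r + 2 ≤ ρ) :
    (ball G (Φ.free F) (Φ.seed F e) r).ncard + (nbhd G (ball G (Φ.free F) (Φ.seed F e) r)).ncard ≤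
      (ball G (Φ.free F) (Φ.seed F e) (r + 1)).ncard +
        (Φ.core.ncard + Fintype.card I * (r + 2)) := by
  have h1 := ncard_ball_succ G (Φ.free F) (Φ.seed F e) r
  have h2 := (Set.ncard_le_ncard (h.nbhd_ball_diff_subset hsep he hv hr)).trans
    (Set.ncard_union_le _ _)
  have h3 := ncard_lowSet_le F (r + 1)
  rw [show r + 1 + 1 = r + 2 by rfl] at h3
  omega

theorem Frame.IsOptimal.ncard_seed_ge [Finite V] (h : Φ.IsOptimal F) (hsep : Φ.Separated G L ρ)
    {e : I} (he : F e = none) (hv : Φ.start e ∉ L) (hρ : 1 ≤ ρ) :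
    (G.neighborSet (Φ.start e)).ncard ≤
      (Φ.seed F e).ncard + (Φ.core.ncard + Fintype.card I) := by
  have h1 := Set.ncard_inter_add_ncard_sdiff_eq_ncard (G.neighborSet (Φ.start e)) (Φ.free F)
  have h2 : G.neighborSet (Φ.start e) \ Φ.free F ⊆ Φ.core ∪ lowSet F 0 := by
    rintro y ⟨hadj, hy⟩
    rcases h.nbr_start hsep he hv hρ hadj hy with hy | ⟨e', b', hb', hy⟩
    · exact Or.inl hy
    · exact Or.inr ⟨e', b', hb', 0, le_rfl, by rw [Walk.getVert_zero, hy]⟩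
  have h3 := (Set.ncard_le_ncard h2).trans (Set.ncard_union_le _ _)
  have h4 := ncard_lowSet_le F 0
  unfold Frame.seed
  omega

end Local

section Cycle

variable {k : ℕ} {Φ : Frame V (Fin k × Fin 2)} {G : SimpleGraph V}
  {F : Fin k × Fin 2 → Option (Arm G)} {L : Set V} {ρ : ℕ} {C : Copy (cycleGraph k) G}

/-- The possible blockers are the two cycle neighbours and the first vertex of the other arm at the
same cycle vertex. A chord, or a common neighbour with another cycle vertex, would close a cycle
shorter than the girth. -/
theorem Frame.IsOptimal.ncard_nbr_diff_free_le [Finite V] (h : Φ.IsOptimal F)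
    (hsep : Φ.Separated G L ρ)
    (hcore : Φ.core = Set.range C) (hstart : ∀ e, Φ.start e = C e.1) (hk : 5 ≤ k)
    (hg : ∀ (a : V) (c : G.Walk a a), c.IsCycle → k ≤ c.length)
    {e : Fin k × Fin 2} (he : F e = none) (hv : Φ.start e ∉ L) (hρ : 1 ≤ ρ) :
    (G.neighborSet (Φ.start e) \ Φ.free F).ncard ≤ 3 := by
  classical
  have hsub : G.neighborSet (Φ.start e) \ Φ.free F ⊆
      (C '' ((cycleGraph k).neighborSet e.1)) ∪ {y | ∃ b', F (e.1, 1 - e.2) = some b' ∧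
        b'.fst = y} := by
    rintro y ⟨hadj, hy⟩
    have hadj' : G.Adj (C e.1) y := by rw [← hstart]; exact hadj
    rcases h.nbr_start hsep he hv hρ hadj hy with hy | ⟨e', b', hb', hy⟩
    · rw [hcore] at hy
      obtain ⟨j, rfl⟩ := hy
      obtain ⟨w, hw, hlen, -, hone⟩ := exists_cycle_arc (by omega) C e.1 j
      have := path_unique_of_short hg hw (q := hadj'.toWalk) (by simp [hadj'.ne]) (by
        simp only [Walk.length_cons, Walk.length_nil, SimpleGraph.Adj.toWalk]; omega)
      exact Or.inl ⟨j, hone (by rw [this]; rfl), rfl⟩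
    · right
      have hA := h.1.isArm e' b' hb'
      have hyc : y ∉ Set.range C := by
        rw [← hcore, ← hy]; exact hA.avoid _ b'.walk.start_mem_support
      have hadj2 : G.Adj y (C e'.1) := by rw [← hstart, ← hy]; exact hA.adj.symm
      by_cases h1 : e'.1 = e.1
      · have h2 : e' = (e.1, 1 - e.2) := by
          have hne : e' ≠ e := by rintro rfl; simp [he] at hb'
          have : e'.2 ≠ e.2 := fun h => hne (Prod.ext h1 h)
          refine Prod.ext h1 ?_
          change e'.2 = 1 - e.2
          revert this
          generalize e'.2 = u
          generalize e.2 = u'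
          revert u u'
          decide
        exact ⟨b', h2 ▸ hb', hy⟩
      · exfalso
        obtain ⟨w, hw, hlen, hwC, hone⟩ := exists_cycle_arc (by omega) C e.1 e'.1
        have hne : C e.1 ≠ C e'.1 := fun h => h1 (C.injective h).symm
        have hp : (Walk.cons hadj' hadj2.toWalk).IsPath := by
          simp [hadj'.ne, hadj2.ne, hne]
        have := path_unique_of_short hg hw hp (by
          simp only [Walk.length_cons, Walk.length_nil, SimpleGraph.Adj.toWalk]; omega)
        exact hyc (hwC y (by rw [this]; simp))
  have h1 : (C '' ((cycleGraph k).neighborSet e.1)).ncard ≤ 2 := by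
    refine (Set.ncard_image_le (Set.toFinite _)).trans ?_
    obtain ⟨n, rfl⟩ : ∃ n, k = n + 3 := ⟨k - 3, by omega⟩
    have := cycleGraph_degree_three_le (v := e.1)
    rw [Set.ncard_eq_toFinset_card']
    exact this.le
  have h2 : {y | ∃ b', F (e.1, 1 - e.2) = some b' ∧ b'.fst = y}.ncard ≤ 1 := by
    rw [Set.ncard_le_one]
    rintro a ⟨b, hb, rfl⟩ a' ⟨b', hb', rfl⟩
    rw [hb] at hb'
    rw [Option.some.inj hb']
  have := (Set.ncard_le_ncard hsub).trans (Set.ncard_union_le _ _)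
  omega

/-- Up to depth k/8 the tree from v is never blocked after its first step. A blocked vertex is also
reached from v along the shorter arc of the cycle and the beginning of an arm, and the two routes
together are shorter than the girth. -/
theorem Frame.IsOptimal.pow_le_ncard_ball [Finite V] (h : Φ.IsOptimal F)
    (hsep : Φ.Separated G L ρ)
    (hcore : Φ.core = Set.range C) (hstart : ∀ e, Φ.start e = C e.1) (hk : 9 ≤ k)
    (hg : ∀ (a : V) (c : G.Walk a a), c.IsCycle → k ≤ c.length) {D : ℕ} (hD4 : 4 ≤ D)
    (hD : ∀ x, D ≤ (G.neighborSet x).ncard)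
    {e : Fin k × Fin 2} (he : F e = none) (hv : Φ.start e ∉ L) {q : ℕ} (hq : q ≤ k / 8)
    (hqρ : q + 2 ≤ ρ) :
    (D - 1) ^ q ≤ (ball G (Φ.free F) (Φ.seed F e) q).ncard := by
  classical
  have hne : (treeLayer G (Φ.free F) (Φ.start e) 1).Nonempty := by
    have h1 := h.ncard_nbr_diff_free_le hsep hcore hstart (by omega) hg he hv (by omega)
    have h2 := Set.ncard_inter_add_ncard_sdiff_eq_ncard (G.neighborSet (Φ.start e)) (Φ.free F)
    have h3 := hD (Φ.start e)
    have h4 : 0 < (G.neighborSet (Φ.start e) ∩ Φ.free F).ncard := by omega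
    obtain ⟨y, hy, hy'⟩ := (Set.ncard_pos).1 h4
    exact treeLayer_one_nonempty hy hy'
  refine (pow_le_ncard_treeLayer (R := q) hg hD (by omega) hne ?_).trans
    (Set.ncard_le_ncard (treeLayer_subset_ball q))
  intro r hr1 hrq x y p hxy hpath hlen hF hconc
  by_contra hy
  cases p with
  | nil => simp at hlen; omega
  | cons hadj p =>
    rename_i a
    rw [Walk.length_cons] at hlen
    rw [Walk.cons_isPath_iff] at hpath
    have hp : ∀ z ∈ p.support, z ∈ Φ.free F := fun z hz => by
      rcases hF z (by simp [hz]) with rfl | h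
      exacts [absurd hz hpath.2, h]
    have hcase : ∃ w : G.Walk (Φ.start e) y, w.length ≤ k / 2 + 1 + r ∧
        ∀ z ∈ w.support, z ∈ Φ.core ∪ occupied F := by
      rcases h.mem_of_notMem_free hsep he hv hadj p hp hxy (by omega) hy with
        hy | ⟨e', b', hb', -, w', hw', hwb⟩
      · rw [hcore] at hy
        obtain ⟨j, rfl⟩ := hy
        obtain ⟨w, -, hl, hwC, -⟩ := exists_cycle_arc (by omega) C e.1 j
        refine ⟨w.copy (hstart e).symm rfl, by rw [Walk.length_copy]; omega, fun z hz => ?_⟩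
        rw [Walk.support_copy] at hz
        exact Or.inl (hcore ▸ hwC z hz)
      · obtain ⟨w, -, hl, hwC, -⟩ := exists_cycle_arc (by omega) C e.1 e'.1
        have hA := h.1.isArm e' b' hb'
        refine ⟨(w.copy (hstart e).symm (hstart e').symm).append (.cons hA.adj w'), ?_, ?_⟩
        · rw [Walk.length_append, Walk.length_copy, Walk.length_cons]; omega
        · intro z hz
          rw [Walk.mem_support_append_iff, Walk.support_copy, Walk.support_cons,
            List.mem_cons] at hz
          rcases hz with hz | rfl | hz
          · exact Or.inl (hcore ▸ hwC z hz)
          · exact Or.inl (hsep.start_mem e')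
          · exact Or.inr ⟨e', b', hb', hwb z hz⟩
    obtain ⟨w, hw, hwW⟩ := hcase
    have hb := w.length_bypass_le_length
    -- The routes coincide, yet the tree path begins with the free vertex a while the other stays in
    -- the core and the arms.
    have heq := path_unique_of_short hg hconc w.bypass_isPath (by
      rw [Walk.length_concat, Walk.length_cons]; omega)
    have ha : a ∈ w.bypass.support := by
      rw [← heq, Walk.support_concat]
      simp
    exact hp a p.start_mem_support (Or.inl (hwW a (w.support_bypass_subset_support ha)))

end Cycle

end KrakenLemma

/-! ### Polynomial growth of the free ball -/

namespace KrakenLemma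

variable {V : Type*}

theorem one_add_pow_le {u : ℝ} (h0 : 0 ≤ u) (h1 : u ≤ 1 / 80) : (1 + u) ^ 40 ≤ 1 + 80 * u := by
  have h2 : 1 - 40 * u ≤ (1 - u) ^ 40 := by
    have := one_add_mul_le_pow (a := -u) (by linarith) 40
    norm_num at this
    linarith [this, show (1 + -u) = 1 - u by ring, sub_eq_add_neg 1 u]
  have h3 : (1 + u) ^ 40 * (1 - u) ^ 40 ≤ 1 := by
    rw [← mul_pow]
    exact pow_le_one₀ (by nlinarith) (by nlinarith)
  have h4 : (1 + u) ^ 40 * (1 - 40 * u) ≤ 1 :=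
    (mul_le_mul_of_nonneg_left h2 (by positivity)).trans h3
  have h5 : 1 ≤ (1 + 80 * u) * (1 - 40 * u) := by nlinarith
  exact le_of_mul_le_mul_right (h4.trans h5) (by linarith)

/-- Writing x = t^40, the bound log² x ≤ 6400 t makes the expansion at least c t^39 with c = ε/6400.
Half of it pays for raising y to y + δ, which costs at most 80 δ y^39, and half for the quadratic
loss, once y is large. -/
theorem exists_growth_constants {ε : ℝ} (hε : 0 < ε) (hε1 : ε < 1) :
    ∃ Y δ : ℝ, 1 ≤ Y ∧ 0 < δ ∧ δ ≤ 1 ∧ ∀ y, Y ≤ y → ∀ x, y ^ 40 ≤ x →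
      (y + δ) ^ 40 + 3 * (y / δ + 2) ^ 2 ≤ x + ε * x / Real.log x ^ 2 := by
  set c := ε / 6400 with hc
  have hc0 : 0 < c := by positivity
  set δ := c / 160 with hδ
  have hδ0 : 0 < δ := by positivity
  have hδ1 : δ ≤ 1 / 80 := by rw [hδ, hc]; linarith
  set E := 3 * (1 / δ + 2) ^ 2 with hE
  refine ⟨max 2 (2 * E / c), δ, le_max_of_le_left (by norm_num), hδ0, by linarith, ?_⟩
  intro y hy x hx
  have hy2 : 2 ≤ y := (le_max_left _ _).trans hy
  have hyE : 2 * E / c ≤ y := (le_max_right _ _).trans hy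
  have hx1 : 1 < x := lt_of_lt_of_le (one_lt_pow₀ (by linarith) (by norm_num)) hx
  obtain ⟨t, ht0, rfl⟩ : ∃ t : ℝ, 0 ≤ t ∧ t ^ 40 = x :=
    ⟨x ^ ((40 : ℕ) : ℝ)⁻¹, by positivity, Real.rpow_inv_natCast_pow (by linarith) (by norm_num)⟩
  have hty : y ≤ t := le_of_pow_le_pow_left₀ (by norm_num) ht0 hx
  have ht1 : 1 < t := by linarith
  have hlog : Real.log (t ^ 40) ^ 2 ≤ 6400 * t := by
    have hs : Real.log (t ^ 40) = 80 * Real.log √t := by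
      rw [Real.log_pow, Real.log_sqrt ht0]; push_cast; ring
    have h1 : Real.log √t ≤ √t := (Real.log_le_sub_one_of_pos (by positivity)).trans (by linarith)
    have h2 : 0 ≤ Real.log √t := Real.log_nonneg (Real.one_le_sqrt.2 ht1.le)
    have h3 := Real.sq_sqrt ht0
    rw [hs]
    nlinarith
  have hlogpos : 0 < Real.log (t ^ 40) := Real.log_pos hx1
  have h1 : c * t ^ 39 ≤ ε * t ^ 40 / Real.log (t ^ 40) ^ 2 := by
    calc c * t ^ 39 = ε * t ^ 40 / (6400 * t) := by rw [hc]; field_simp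
      _ ≤ _ := by gcongr
  have h2 : c * y ^ 39 ≤ c * t ^ 39 := by gcongr
  have h3 : (y + δ) ^ 40 ≤ y ^ 40 + c / 2 * y ^ 39 := by
    have h4 := one_add_pow_le (u := δ / y) (by positivity) (by
      rw [div_le_iff₀ (by linarith)]; nlinarith)
    have h5 : (y + δ) ^ 40 = y ^ 40 * (1 + δ / y) ^ 40 := by
      rw [← mul_pow]; congr 1; field_simp
    rw [h5]
    calc y ^ 40 * (1 + δ / y) ^ 40 ≤ y ^ 40 * (1 + 80 * (δ / y)) := by gcongr
      _ = y ^ 40 + c / 2 * y ^ 39 := by rw [hδ]; field_simp; ring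
  have h4 : 3 * (y / δ + 2) ^ 2 ≤ c / 2 * y ^ 39 := by
    have h5 : y / δ + 2 ≤ y * (1 / δ + 2) := by
      rw [mul_add, mul_one_div]; linarith
    calc 3 * (y / δ + 2) ^ 2 ≤ 3 * (y * (1 / δ + 2)) ^ 2 := by gcongr
      _ = E * y ^ 2 := by rw [hE]; ring
      _ ≤ (c / 2 * y) * y ^ 2 := by
          gcongr
          rw [div_le_iff₀ hc0] at hyE
          linarith
      _ = c / 2 * y ^ 3 := by ring
      _ ≤ c / 2 * y ^ 39 := by
          gcongr
          · linarith
          · norm_num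
  linarith

/-- At y = Y + δ(κ + r) one has κ + r ≤ y/δ, so the quadratic allowance in `hstep` covers the loss κ
+ 2κ(r + 2). Having κ in the argument keeps the constants independent of the cycle length. -/
theorem growth_induction {a : ℕ → ℝ} {P : ℝ → ℝ} {ε Y δ κ N K : ℝ} {r₀ R : ℕ} (hmono : Monotone a)
    (hY : 0 ≤ Y) (hδ : 0 < δ) (hκ : 0 ≤ κ)
    (hstep : ∀ y, Y ≤ y → ∀ x, P y ≤ x →
      P (y + δ) + 3 * (y / δ + 2) ^ 2 ≤ x + ε * x / Real.log x ^ 2)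
    (hK : K ≤ a r₀) (h0 : P (Y + δ * (κ + r₀)) ≤ a r₀) (hR : r₀ ≤ R)
    (ha : ∀ r, r₀ ≤ r → r < R → K ≤ a r → a r ≤ N →
      a r + ε * a r / Real.log (a r) ^ 2 ≤ a (r + 1) + (κ + 2 * κ * (r + 2))) :
    N < a R ∨ P (Y + δ * (κ + R)) ≤ a R := by
  by_contra! hcon
  obtain ⟨h1, h2⟩ := hcon
  have key : ∀ r, r₀ ≤ r → r ≤ R → P (Y + δ * (κ + r)) ≤ a r := by
    intro r hr
    induction r, hr using Nat.le_induction with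
    | base => exact fun _ => h0
    | succ r hr ih =>
      intro hrR
      have ih := ih (by omega)
      have h3 := ha r hr (by omega) (hK.trans (hmono hr)) ((hmono (by omega)).trans h1)
      have hp : 0 ≤ δ * (κ + r) := by positivity
      have h4 := hstep (Y + δ * (κ + r)) (by linarith) _ ih
      have h5 : κ + r + 2 ≤ (Y + δ * (κ + r)) / δ + 2 := by
        rw [add_div, mul_div_cancel_left₀ _ hδ.ne']
        have : 0 ≤ Y / δ := by positivity
        linarith
      have h6 : (κ + r + 2) ^ 2 ≤ ((Y + δ * (κ + r)) / δ + 2) ^ 2 := by gcongr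
      have hr0 : (0:ℝ) ≤ r := by positivity
      have h7 : κ + 2 * κ * (r + 2) ≤ 3 * (κ + r + 2) ^ 2 := by nlinarith [mul_nonneg hκ hr0]
      have h8 : Y + δ * (κ + ((r + 1 : ℕ) : ℝ)) = Y + δ * (κ + r) + δ := by push_cast; ring
      rw [h8]
      linarith
  exact absurd (key R hR le_rfl) (not_le.2 h2)

/-- Tree growth to depth q = k/8 is exponential in k, as k ≤ 16q, and so beats the polynomial needed
to start the induction at radius q. -/
theorem start_bound {Y δ D : ℝ} {k : ℕ} (hY : 1 ≤ Y) (hδ : 0 < δ) (hδ1 : δ ≤ 1)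
    (hD : (2 * (Y + 30)) ^ 40 ≤ D) (hk : 16 ≤ k) :
    (Y + δ * (k + (k / 8 : ℕ))) ^ 40 ≤ D ^ (k / 8) := by
  obtain ⟨q, hq⟩ : ∃ q, k / 8 = q := ⟨_, rfl⟩
  rw [hq]
  have hq1 : 1 ≤ q := by omega
  have hk' : (k:ℝ) ≤ 16 * q := by exact_mod_cast (show k ≤ 16 * q by omega)
  have hq1' : (1:ℝ) ≤ q := by exact_mod_cast hq1
  have h1 : Y + δ * (k + q) ≤ (Y + 30) * q := by
    have : δ * (k + q) ≤ 1 * (k + q) := by gcongr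
    nlinarith
  have h2 : (q:ℝ) ≤ 2 ^ q := by exact_mod_cast Nat.lt_two_pow_self.le
  have h3 : Y + δ * (k + q) ≤ (2 * (Y + 30)) ^ q := by
    calc Y + δ * (k + q) ≤ (Y + 30) * q := h1
      _ ≤ (Y + 30) ^ q * 2 ^ q := by
          gcongr
          exact le_self_pow₀ (by linarith) (by omega)
      _ = _ := by rw [← mul_pow]; ring
  calc (Y + δ * (k + q)) ^ 40 ≤ ((2 * (Y + 30)) ^ q) ^ 40 := by gcongr
    _ = ((2 * (Y + 30)) ^ 40) ^ q := by rw [← pow_mul, ← pow_mul, mul_comm q]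
    _ ≤ D ^ q := by gcongr

theorem ncard_range_copy {W : Type*} {k : ℕ} {H : SimpleGraph (Fin k)} {G : SimpleGraph W}
    (C : Copy H G) : (Set.range C).ncard = k := by
  rw [← Set.image_univ, Set.ncard_image_of_injective Set.univ (f := ⇑C) C.injective,
    Set.ncard_univ, Nat.card_eq_fintype_card, Fintype.card_fin]

variable {k : ℕ} {Φ : Frame V (Fin k × Fin 2)} {G : SimpleGraph V}
  {F : Fin k × Fin 2 → Option (Arm G)} {L : Set V} {R : ℕ} {C : Copy (cycleGraph k) G}

/-- The free ball around an unserved vertex of low degree becomes large. -/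
theorem Frame.IsOptimal.ball_large [Fintype V] (h : Φ.IsOptimal F)
    (hsep : Φ.Separated G L (R + 2))
    (hcore : Φ.core = Set.range C) (hstart : ∀ e, Φ.start e = C e.1)
    (hg : ∀ (a : V) (c : G.Walk a a), c.IsCycle → k ≤ c.length) {D : ℕ}
    (hD : ∀ x, D ≤ (G.neighborSet x).ncard)
    {e : Fin k × Fin 2} (he : F e = none) (hv : Φ.start e ∉ L)
    {ε Y δ ℓ : ℝ} (hG : Expands G ε (D / 2)) (hY : 1 ≤ Y) (hδ : 0 < δ) (hδ1 : δ ≤ 1)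
    (hstep : ∀ y, Y ≤ y → ∀ x, y ^ 40 ≤ x →
      (y + δ) ^ 40 + 3 * (y / δ + 2) ^ 2 ≤ x + ε * x / Real.log x ^ 2)
    (hDY : (2 * (Y + 30)) ^ 40 ≤ (D : ℝ) - 1) (hR : 1 ≤ R)
    (hℓ1 : ℓ ^ 15 ≤ (δ * R) ^ 40) (hℓ2 : ℓ ^ 15 ≤ 2 ^ R) (hℓ3 : ℓ ^ 15 ≤ Fintype.card V / 2) :
    (D / 2 : ℝ) ≤ (ball G (Φ.free F) (Φ.seed F e) R).ncard ∧
      ℓ ^ 15 ≤ (ball G (Φ.free F) (Φ.seed F e) R).ncard := by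
  have hDbig : (62:ℝ) ^ 40 ≤ D - 1 :=
    le_trans (pow_le_pow_left₀ (by norm_num) (by linarith) 40) hDY
  have hD100 : (1000:ℝ) ≤ D - 1 := le_trans (by norm_num) hDbig
  clear hDbig
  have hD1000 : 1000 ≤ D := by
    have : (1000:ℝ) ≤ D := by linarith
    exact_mod_cast this
  have hDcast : ((D - 1 : ℕ) : ℝ) = D - 1 := by rw [Nat.cast_sub (by omega)]; simp
  have hDn : (D:ℝ) ≤ Fintype.card V := by
    have h1 := hD (Φ.start e)
    have h2 := Set.ncard_le_card (G.neighborSet (Φ.start e))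
    rw [Nat.card_eq_fintype_card] at h2
    exact_mod_cast h1.trans h2
  obtain ⟨P, hP⟩ : ∃ P : ℝ → ℝ, ∀ y, P y = y ^ 40 := ⟨_, fun _ => rfl⟩
  have hstart0 : 16 ≤ k → P (Y + δ * (k + (k / 8 : ℕ))) ≤ ((D:ℝ) - 1) ^ (k / 8) := fun hk => by
    rw [hP]; exact start_bound hY hδ hδ1 hDY hk
  have hDY' : 2 * P (Y + 30) ≤ D - 1 := by
    refine le_trans ?_ hDY
    rw [hP, mul_pow]; gcongr; norm_num
  simp only [← hP] at hstep hℓ1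
  have hPmono : ∀ x y, 0 ≤ x → x ≤ y → P x ≤ P y := fun x y h h' => by
    rw [hP, hP]; exact pow_le_pow_left₀ h h' 40
  clear hDY
  clear hP
  have hcoreK : Φ.core.ncard = k := by rw [hcore, ncard_range_copy]
  have hI : Fintype.card (Fin k × Fin 2) = k * 2 := by simp
  set a : ℕ → ℝ := fun r => ((ball G (Φ.free F) (Φ.seed F e) r).ncard : ℝ) with ha
  have hmono : Monotone a := fun i j hij => by
    have := Set.ncard_le_ncard (ball_mono G (Φ.free F) (Φ.seed F e) hij)
    simp only [ha]
    exact_mod_cast this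
  have hrec : ∀ r, r < R → (D / 2 : ℝ) ≤ a r → a r ≤ Fintype.card V / 2 →
      a r + ε * a r / Real.log (a r) ^ 2 ≤ a (r + 1) + (k + 2 * k * (r + 2)) := by
    intro r hr h1 h2
    have h3 := hG _ h1 h2
    have h4 := h.ncard_ball_succ_ge hsep he hv (r := r) (by omega)
    rw [hcoreK, hI] at h4
    have h5 : a r + ((nbhd G (ball G (Φ.free F) (Φ.seed F e) r)).ncard : ℝ) ≤
        a (r + 1) + (k + k * 2 * (r + 2)) := by
      simp only [ha]; exact_mod_cast h4
    simp only [ha] at h3 h5 ⊢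
    linarith
  have hfin : ∀ r₀, r₀ ≤ R → (D / 2 : ℝ) ≤ a r₀ → P (Y + δ * (k + r₀)) ≤ a r₀ →
      (D / 2 : ℝ) ≤ a R ∧ ℓ ^ 15 ≤ a R := by
    intro r₀ hr hK h0
    refine ⟨hK.trans (hmono hr), ?_⟩
    rcases growth_induction (N := Fintype.card V / 2) hmono (by linarith) hδ (Nat.cast_nonneg k)
      hstep hK h0 hr (fun r _ hr => hrec r hr) with h1 | h1
    · linarith
    · refine hℓ1.trans (le_trans ?_ h1)
      refine hPmono _ _ (by positivity) ?_
      have : δ * R ≤ δ * (k + R) := by gcongr; simp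
      linarith
  -- For short cycles the at most 3k ≤ 45 blocked neighbours are negligible against D, and the
  -- induction starts at radius 0.
  by_cases hk : k < 16
  · refine hfin 0 (Nat.zero_le _) ?_ ?_
    all_goals
      have h1 := h.ncard_seed_ge hsep he hv (by omega)
      rw [hcoreK, hI] at h1
      have h2 := hD (Φ.start e)
      have h3 : (D:ℝ) ≤ a 0 + 45 := by
        have : D ≤ (Φ.seed F e).ncard + 45 := by omega
        simp only [ha, ball]; exact_mod_cast this
    · linarith
    · have h4 : (k:ℝ) ≤ 15 := by exact_mod_cast (show k ≤ 15 by omega)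
      have h5 : Y + δ * (k + (0:ℕ)) ≤ Y + 30 := by
        have : δ * (k + (0:ℕ)) ≤ 1 * (k + (0:ℕ)) := by gcongr
        push_cast at this ⊢
        linarith
      have h6 := hPmono _ _ (by positivity) h5
      linarith
  · push Not at hk
    have htree : ∀ q, q ≤ k / 8 → q ≤ R → ((D:ℝ) - 1) ^ q ≤ a q := by
      intro q hq hqR
      have := h.pow_le_ncard_ball hsep hcore hstart (by omega) hg (by omega) hD he hv hq
        (by omega)
      rw [← hDcast]
      simp only [ha]
      exact_mod_cast this
    have hhalf : ∀ q, 1 ≤ q → (D / 2 : ℝ) ≤ ((D:ℝ) - 1) ^ q := fun q hq => by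
      refine le_trans ?_ (le_self_pow₀ (by linarith) (by omega))
      linarith
    by_cases hkR : k / 8 ≤ R
    · refine hfin (k / 8) hkR ((hhalf _ (by omega)).trans (htree _ le_rfl hkR)) ?_
      exact (hstart0 hk).trans (htree _ le_rfl hkR)
    -- When k/8 exceeds R the ball is tree-like all the way, and 2^R is already enough.
    · have h1 := htree R (by omega) le_rfl
      refine ⟨(hhalf R hR).trans h1, hℓ2.trans (le_trans ?_ h1)⟩
      gcongr
      linarith

end KrakenLemma

/-! ### Every index is served -/

namespace KrakenLemma

variable {V : Type*} {k : ℕ} {Φ : Frame V (Fin k × Fin 2)} {G : SimpleGraph V}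
  {F : Fin k × Fin 2 → Option (Arm G)} {L : Set V} {R : ℕ} {C : Copy (cycleGraph k) G}

/-- The unused targets contain or are adjacent to large sets, robustly. -/
def Frame.Rich {I : Type*} (Φ : Frame V I) (G : SimpleGraph V) (c : ℕ) (K ℓ : ℝ) : Prop :=
  ∀ W U : Set V, Φ.core ⊆ W → (W.ncard : ℝ) ≤ ℓ ^ 12 → U.ncard < c →
    (∀ t ∈ Φ.T, t ∈ W → Φ.lab t ∈ U) →
    ∃ Y : Set V, K ≤ Y.ncard ∧ ℓ ^ 15 ≤ Y.ncard ∧ Disjoint Y W ∧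
      ∀ y ∈ Y, (y ∈ Φ.T ∧ Φ.lab y ∉ U) ∨ ∃ t ∈ Φ.T, Φ.lab t ∉ U ∧ G.Adj y t

theorem ncard_label_fiber_le [Fintype V] {I : Type*} (Φ : Frame V I) {s : ℕ}
    (hs : ∀ a, {t | t ∈ Φ.T ∧ Φ.lab t = a}.ncard ≤ s) (U : Set V) :
    {t | t ∈ Φ.T ∧ Φ.lab t ∈ U}.ncard ≤ U.ncard * s := by
  classical
  have hsub : {t | t ∈ Φ.T ∧ Φ.lab t ∈ U} ⊆
      (U.toFinset.biUnion fun a => {t | t ∈ Φ.T ∧ Φ.lab t = a}.toFinset : Finset V) := by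
    intro t ht
    simp only [Finset.coe_biUnion, Set.coe_toFinset, Set.mem_iUnion]
    exact ⟨Φ.lab t, ht.2, ht.1, rfl⟩
  have h1 := Set.ncard_le_ncard hsub
  rw [Set.ncard_coe_finset] at h1
  rw [Set.ncard_eq_toFinset_card' U]
  refine h1.trans (Finset.card_biUnion_le_card_mul _ _ s fun a _ => ?_)
  rw [← Set.ncard_eq_toFinset_card']
  exact hs a

/-- An unserved start has a large reachable set: its neighbourhood if it lies in L, the free ball
otherwise. Joining this set to the one supplied by `Frame.Rich`, avoiding everything in use,
produces a forbidden extension. -/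
theorem Frame.IsOptimal.ne_none [Fintype V] (h : Φ.IsOptimal F)
    (hsep : Φ.Separated G L (R + 2))
    (hcore : Φ.core = Set.range C) (hstart : ∀ e, Φ.start e = C e.1)
    (hg : ∀ (a : V) (c : G.Walk a a), c.IsCycle → k ≤ c.length) {D : ℕ}
    (hD : ∀ x, D ≤ (G.neighborSet x).ncard)
    {ε Y δ ℓ : ℝ} (hε : 0 < ε) (hε1 : ε < 1) (hG : Expands G ε (D / 2)) (hY : 1 ≤ Y) (hδ : 0 < δ)
    (hδ1 : δ ≤ 1)
    (hstep : ∀ y, Y ≤ y → ∀ x, y ^ 40 ≤ x →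
      (y + δ) ^ 40 + 3 * (y / δ + 2) ^ 2 ≤ x + ε * x / Real.log x ^ 2)
    (hDY : (2 * (Y + 30)) ^ 40 ≤ (D : ℝ) - 1) (hR : 1 ≤ R)
    (hℓ : ℓ = Real.log (Fintype.card V)) (hℓε : 2 ≤ ε * ℓ)
    (hℓ1 : ℓ ^ 15 ≤ (δ * R) ^ 40) (hℓ2 : ℓ ^ 15 ≤ 2 ^ R) (hℓ3 : ℓ ^ 15 ≤ Fintype.card V / 2)
    {s : ℕ} (hs : ∀ a, {t | t ∈ Φ.T ∧ Φ.lab t = a}.ncard ≤ s)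
    (hdegL : ∀ l ∈ L, ℓ ^ 100 ≤ ((G.neighborSet l).ncard : ℝ))
    (hW : (k : ℝ) + 2 * k * Φ.M + 2 * k * s ≤ ℓ ^ 12)
    (hM : R + 2 * ⌈4 * ℓ ^ 3 / ε⌉₊ + 4 ≤ Φ.M)
    (hrich : Φ.Rich G (2 * k) (D / 2) ℓ) (e : Fin k × Fin 2) : F e ≠ none := by
  intro he
  have hℓ2' : 2 < ℓ := by nlinarith
  have hI : Fintype.card (Fin k × Fin 2) = 2 * k := by simp [mul_comm]
  have hU := ncard_usedLab_lt (Φ := Φ) he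
  rw [hI] at hU
  set U := Φ.usedLab F with hUdef
  -- Whole cells with a used label are avoided, so that any target met has an unused label.
  set W : Set V := Φ.core ∪ occupied F ∪ {t | t ∈ Φ.T ∧ Φ.lab t ∈ U} with hWdef
  have hWcard : (W.ncard : ℝ) ≤ ℓ ^ 12 := by
    refine le_trans ?_ hW
    have h1 : W.ncard ≤ k + 2 * k * Φ.M + 2 * k * s := by
      have h1 := Set.ncard_union_le (Φ.core ∪ occupied F) {t | t ∈ Φ.T ∧ Φ.lab t ∈ U}
      rw [← hWdef] at h1
      have h2 := Set.ncard_union_le Φ.core (occupied F)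
      have h3 : Φ.core.ncard = k := by rw [hcore, ncard_range_copy]
      have h4 := (Set.ncard_le_ncard (occupied_subset_lowSet h.1)).trans
        (ncard_lowSet_le F (Φ.M - 1))
      rw [hI, Nat.sub_add_cancel (by omega)] at h4
      have h5 := ncard_label_fiber_le Φ hs U
      have h6 : U.ncard * s ≤ 2 * k * s := Nat.mul_le_mul_right _ hU.le
      omega
    exact_mod_cast h1
  have hWT : ∀ t ∈ Φ.T, t ∈ W → Φ.lab t ∈ U := by
    rintro t ht ((h1 | ⟨e', b', hb', h1⟩) | h1)
    · exact absurd h1 (hsep.disj t ht)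
    · have := (h.1.isArm e' b' hb').eq_lst t h1 ht
      exact ⟨e', b', hb', by rw [this]⟩
    · exact h1.2
  obtain ⟨Z, hZK, hZℓ, hZW, hZ⟩ := hrich W U
    (Set.subset_union_left.trans Set.subset_union_left) hWcard hU hWT
  have hX : ∃ X : Set V, (D / 2 : ℝ) ≤ X.ncard ∧ ℓ ^ 15 ≤ X.ncard ∧ X ⊆ Wᶜ ∧ ∀ x ∈ X,
      ∃ a, G.Adj (Φ.start e) a ∧ ∃ p : G.Walk a x, p.length ≤ R ∧ ∀ z ∈ p.support, z ∉ W := by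
    by_cases hv : Φ.start e ∈ L
    · refine ⟨G.neighborSet (Φ.start e) \ W, ?_⟩
      have h1 := hdegL _ hv
      have h2 : (D : ℝ) ≤ (G.neighborSet (Φ.start e)).ncard := by exact_mod_cast hD _
      have h3 : ((G.neighborSet (Φ.start e)).ncard : ℝ) ≤
          (G.neighborSet (Φ.start e) \ W).ncard + W.ncard := by
        exact_mod_cast Set.ncard_le_ncard_sdiff_add_ncard _ _
      have h4 : ℓ ^ 12 ≤ ℓ ^ 15 := pow_le_pow_right₀ (by linarith) (by norm_num)
      have h5 : 4 * ℓ ^ 15 ≤ ℓ ^ 100 := by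
        have h6 : (4:ℝ) ≤ ℓ ^ 2 := by nlinarith
        calc 4 * ℓ ^ 15 ≤ ℓ ^ 2 * ℓ ^ 15 := by gcongr
          _ = ℓ ^ 17 := by ring
          _ ≤ ℓ ^ 100 := pow_le_pow_right₀ (by linarith) (by norm_num)
      have h7 : 0 ≤ ℓ ^ 15 := by positivity
      refine ⟨by linarith, by linarith, fun x hx => hx.2, fun x hx => ⟨x, hx.1, .nil, by simp, ?_⟩⟩
      simpa using hx.2
    · obtain ⟨h1, h2⟩ := h.ball_large hsep hcore hstart hg hD he hv hG hY hδ hδ1 hstep hDY hR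
        hℓ1 hℓ2 hℓ3
      have hfree : ∀ z ∈ Φ.free F, z ∉ W := by
        rintro z hz (h3 | h3)
        · exact hz (Or.inl h3)
        · exact hz (Or.inr h3.1)
      refine ⟨_, h1, h2, fun x hx => ?_, fun x hx => ?_⟩
      · obtain ⟨a, -, p, -, hp⟩ := exists_walk_of_mem_seed_ball hx
        exact hfree _ (hp x p.end_mem_support)
      · obtain ⟨a, ha, p, hl, hp⟩ := exists_walk_of_mem_seed_ball hx
        exact ⟨a, ha, p, hl, fun z hz => hfree z (hp z hz)⟩
  obtain ⟨X, hXK, hXℓ, hXW, hX⟩ := hX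
  obtain ⟨x, hx, y, hy, w, hw, hwW⟩ := exists_short_walk (F := Wᶜ) hG hε hε1 hℓ hℓε hXK hXℓ hXW hZK
    hZℓ (fun y hy => Set.disjoint_left.1 hZW hy) (by rwa [compl_compl])
  obtain ⟨a, ha, p, hp, hpW⟩ := hX x hx
  have hq : ∀ z ∈ (p.append w).support, z ∉ W := fun z hz => by
    rcases (Walk.mem_support_append_iff _ _).1 hz with hz | hz
    exacts [hpW z hz, hwW z hz]
  have hcoreW : ∀ z, z ∉ W → z ∉ Φ.core ∪ occupied F := fun z hz hc => hz (Or.inl hc)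
  have hlabW : ∀ z, z ∉ W → z ∈ Φ.T → Φ.lab z ∉ U := fun z hz hT hl => hz (Or.inr ⟨hT, hl⟩)
  rcases hZ y hy with ⟨hyT, -⟩ | ⟨t, htT, htU, hyt⟩
  · exact h.no_extension he ha (p.append w) hyT (fun z hz => hcoreW z (hq z hz))
      (fun z hz => hlabW z (hq z hz)) (by rw [Walk.length_append]; omega)
  · have htW : t ∉ W := fun ht => htU (hWT t htT ht)
    have hq' : ∀ z ∈ ((p.append w).concat hyt).support, z ∉ W := fun z hz => by
      rw [Walk.support_concat] at hz
      simp only [List.mem_append, List.mem_singleton] at hz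
      rcases hz with hz | rfl
      exacts [hq z hz, htW]
    exact h.no_extension he ha ((p.append w).concat hyt) htT (fun z hz => hcoreW z (hq' z hz))
      (fun z hz => hlabW z (hq' z hz)) (by rw [Walk.length_concat, Walk.length_append]; omega)

end KrakenLemma

/-! ### Far apart connected cells when L is small -/

namespace KrakenLemma

variable {V : Type*}

theorem exists_walk_in_ball {G : SimpleGraph V} {F : Set V} {z y : V} {r : ℕ}
    (hy : y ∈ ball G F {z} r) :
    ∃ w : G.Walk z y, w.length ≤ r ∧ ∀ x ∈ w.support, x ∈ ball G F {z} r := by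
  induction r generalizing y with
  | zero =>
    obtain rfl : y = z := hy
    exact ⟨.nil, by simp, by simp [ball]⟩
  | succ r ih =>
    have hsub := ball_mono G F {z} (Nat.le_succ r)
    have hy0 := hy
    rcases hy with hy | ⟨hF, x, hx, hxy⟩
    · obtain ⟨w, hw, h⟩ := ih hy
      exact ⟨w, by omega, fun x hx => hsub (h x hx)⟩
    · obtain ⟨w, hw, h⟩ := ih hx
      refine ⟨w.concat hxy, by rw [Walk.length_concat]; omega, fun v hv => ?_⟩
      rw [Walk.support_concat] at hv
      simp only [List.mem_append, List.mem_singleton] at hv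
      rcases hv with hv | rfl
      exacts [hsub (h v hv), hy0]

/-- A large ball contains a set of prescribed size in which all vertices are close to the
centre. -/
theorem exists_cell [Finite V] {G : SimpleGraph V} {F : Set V} {z : V} {r s : ℕ} (hs : 1 ≤ s)
    (h : s ≤ (ball G F {z} r).ncard) :
    ∃ A : Finset V, A.card = s ∧ z ∈ A ∧ (A : Set V) ⊆ ball G F {z} r ∧
      ∀ a ∈ A, ∃ w : G.Walk z a, w.length ≤ r ∧ ∀ x ∈ w.support, x ∈ A := by
  classical
  have := Fintype.ofFinite V
  have hex : ∃ j, s ≤ (ball G F {z} j).ncard := ⟨r, h⟩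
  obtain ⟨j, hj⟩ : ∃ j, Nat.find hex = j := ⟨_, rfl⟩
  have hj1 : s ≤ (ball G F {z} j).ncard := hj ▸ Nat.find_spec hex
  have hjr : j ≤ r := hj ▸ Nat.find_min' hex h
  cases j with
  | zero =>
    simp only [ball, Set.ncard_singleton] at hj1
    refine ⟨{z}, by simp; omega, by simp, ?_, ?_⟩
    · simpa using ball_mono G F {z} (Nat.zero_le r) (rfl : z = z)
    · intro a ha
      obtain rfl : a = z := by simpa using ha
      exact ⟨.nil, by simp, by simp⟩
  | succ j =>
    have hj2 : (ball G F {z} j).ncard < s := not_le.1 (Nat.find_min hex (by omega))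
    have hsub := ball_mono G F {z} (Nat.le_succ j)
    -- At the first radius where the ball reaches size s, any set between the previous ball and this
    -- one works: its extra vertices attach directly to the previous ball.
    obtain ⟨A, hA1, hA2, hA3⟩ := Finset.exists_subsuperset_card_eq
      (s := (ball G F {z} j).toFinset) (t := (ball G F {z} (j + 1)).toFinset) (n := s)
      (Set.toFinset_subset_toFinset.2 hsub)
      (by rw [← Set.ncard_eq_toFinset_card']; exact hj2.le)
      (by rw [← Set.ncard_eq_toFinset_card']; exact hj1)
    have hAball : ∀ a ∈ A, a ∈ ball G F {z} (j + 1) := fun a ha => Set.mem_toFinset.1 (hA2 ha)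
    have hballA : ∀ a ∈ ball G F {z} j, a ∈ A := fun a ha => hA1 (Set.mem_toFinset.2 ha)
    refine ⟨A, hA3, hballA z (ball_mono G F {z} (Nat.zero_le j) rfl), fun a ha =>
      ball_mono G F {z} hjr (hAball a ha), fun a ha => ?_⟩
    rcases hAball a ha with h1 | ⟨-, x, hx, hxa⟩
    · obtain ⟨w, hw, h⟩ := exists_walk_in_ball h1
      exact ⟨w, by omega, fun x hx => hballA x (h x hx)⟩
    · obtain ⟨w, hw, h⟩ := exists_walk_in_ball hx
      refine ⟨w.concat hxa, by rw [Walk.length_concat]; omega, fun v hv => ?_⟩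
      rw [Walk.support_concat] at hv
      simp only [List.mem_append, List.mem_singleton] at hv
      rcases hv with hv | rfl
      exacts [hballA v (h v hv), ha]

theorem ncard_ball_le [Finite V] {G : SimpleGraph V} {F X : Set V} {Δ : ℕ}
    (h : ∀ x ∈ X ∪ F, (G.neighborSet x).ncard ≤ Δ) (r : ℕ) :
    (ball G F X r).ncard ≤ X.ncard * (Δ + 1) ^ r := by
  classical
  have := Fintype.ofFinite V
  induction r with
  | zero => simp [ball]
  | succ r ih =>
    have hsub : ball G F X (r + 1) ⊆ ball G F X r ∪
        ((ball G F X r).toFinset.biUnion fun x => (G.neighborSet x).toFinset : Finset V) := by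
      rintro y (hy | ⟨-, x, hx, hxy⟩)
      · exact Or.inl hy
      · right
        simp only [Finset.coe_biUnion, Set.coe_toFinset, Set.mem_iUnion]
        exact ⟨x, hx, hxy⟩
    have h1 := (Set.ncard_le_ncard hsub).trans (Set.ncard_union_le _ _)
    rw [Set.ncard_coe_finset] at h1
    have h2 := Finset.card_biUnion_le_card_mul (ball G F X r).toFinset
      (fun x => (G.neighborSet x).toFinset) Δ (fun x hx => by
        rw [← Set.ncard_eq_toFinset_card']
        exact h x (ball_subset G F X r (Set.mem_toFinset.1 hx)))
    rw [← Set.ncard_eq_toFinset_card'] at h2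
    calc _ ≤ _ := h1
      _ ≤ (ball G F X r).ncard * (Δ + 1) := by rw [mul_add, mul_one]; omega
      _ ≤ X.ncard * (Δ + 1) ^ r * (Δ + 1) := Nat.mul_le_mul_right _ ih
      _ = _ := by rw [pow_succ, mul_assoc]

/-- Greedy choice of pairwise unrelated points. -/
theorem exists_pairwise_unrelated [Finite V] {rel : V → V → Prop} (hrefl : ∀ z, rel z z)
    (hsymm : ∀ z z', rel z z' → rel z' z) {P : Set V} {b : ℕ} (hb0 : 0 < b)
    (hb : ∀ z ∈ P, {z' | rel z z'}.ncard ≤ b) (m : ℕ) (hm : m * b ≤ P.ncard) :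
    ∃ Z : Finset V, Z.card = m ∧ (Z : Set V) ⊆ P ∧ ∀ z ∈ Z, ∀ z' ∈ Z, z ≠ z' → ¬ rel z z' := by
  classical
  have := Fintype.ofFinite V
  induction m with
  | zero => exact ⟨∅, by simp⟩
  | succ m ih =>
    have hlt : m * b < P.ncard := by rw [Nat.add_mul] at hm; omega
    obtain ⟨Z, hcard, hZP, hZ⟩ := ih hlt.le
    have h1 := Finset.card_biUnion_le_card_mul Z (fun z => {z' | rel z z'}.toFinset) b
      (fun z hz => by rw [← Set.ncard_eq_toFinset_card']; exact hb z (hZP hz))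
    rw [hcard] at h1
    obtain ⟨y, hyP, hy⟩ : ∃ y ∈ P, y ∉ Z.biUnion (fun z => {z' | rel z z'}.toFinset) := by
      by_contra! hcon
      have := Set.ncard_le_ncard (s := P)
        (t := (Z.biUnion (fun z => {z' | rel z z'}.toFinset) : Finset V)) hcon
      rw [Set.ncard_coe_finset] at this
      omega
    have hy' : ∀ z ∈ Z, ¬ rel z y := fun z hz hr =>
      hy (Finset.mem_biUnion.2 ⟨z, hz, Set.mem_toFinset.2 hr⟩)
    have hyZ : y ∉ Z := fun h => hy' y h (hrefl y)
    refine ⟨insert y Z, by rw [Finset.card_insert_of_notMem hyZ, hcard], ?_, ?_⟩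
    · rw [Finset.coe_insert]
      exact Set.insert_subset hyP hZP
    · intro z hz z' hz' hne
      rcases Finset.mem_insert.1 hz with rfl | hz₁ <;>
        rcases Finset.mem_insert.1 hz' with rfl | hz₂
      · exact absurd rfl hne
      · exact fun h => hy' z' hz₂ (hsymm _ _ h)
      · exact hy' z hz₁
      · exact hZ z hz₁ z' hz₂ hne

/-- A small ball has a radius at which it barely grows. -/
theorem exists_slow_radius [Finite V] {G : SimpleGraph V} {F : Set V} {z : V} {ρ s : ℕ} {η : ℝ}
    (hη : 0 ≤ η) (hs : (s : ℝ) ≤ (1 + η) ^ ρ) (h : (ball G F {z} ρ).ncard < s) :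
    ∃ r < ρ, ((nbhd G (ball G F {z} r) ∩ F).ncard : ℝ) ≤ η * (ball G F {z} r).ncard := by
  by_contra! hcon
  have key : ∀ r ≤ ρ, (1 + η) ^ r ≤ ((ball G F {z} r).ncard : ℝ) := by
    intro r
    induction r with
    | zero => intro _; simp [ball]
    | succ r ih =>
      intro hr
      have h1 := ih (by omega)
      have h2 := hcon r (by omega)
      have h3 := Set.ncard_le_ncard (nbhd_ball_subset G F {z} r)
      have h4 := Set.ncard_sdiff_add_ncard_of_subset (ball_mono G F {z} (Nat.le_succ r))
      have h5 : (nbhd G (ball G F {z} r) ∩ F).ncard + (ball G F {z} r).ncard ≤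
          (ball G F {z} (r + 1)).ncard := by
        rw [← h4]; exact Nat.add_le_add_right h3 _
      have h6 : ((nbhd G (ball G F {z} r) ∩ F).ncard : ℝ) + (ball G F {z} r).ncard ≤
          (ball G F {z} (r + 1)).ncard := by exact_mod_cast h5
      calc (1 + η) ^ (r + 1) = (1 + η) ^ r * (1 + η) := pow_succ _ _
        _ ≤ (ball G F {z} r).ncard * (1 + η) := by gcongr
        _ ≤ _ := by linarith
  have h1 := key ρ le_rfl
  have h2 : ((ball G F {z} ρ).ncard : ℝ) < s := by exact_mod_cast h
  linarith

/-- `z` and `z'` are joined by a walk of length at most `t` avoiding `L`. -/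
def Near (G : SimpleGraph V) (L : Set V) (t : ℕ) (z z' : V) : Prop :=
  ∃ w : G.Walk z z', w.length ≤ t ∧ ∀ x ∈ w.support, x ∉ L

theorem Near.symm {G : SimpleGraph V} {L : Set V} {t : ℕ} {z z' : V} (h : Near G L t z z') :
    Near G L t z' z := by
  obtain ⟨w, hw, h⟩ := h
  exact ⟨w.reverse, by simpa using hw, fun x hx => h x (by simpa using hx)⟩

theorem Near.trans {G : SimpleGraph V} {L : Set V} {t t' : ℕ} {x y z : V} (h : Near G L t x y)
    (h' : Near G L t' y z) : Near G L (t + t') x z := by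
  obtain ⟨w, hw, h⟩ := h
  obtain ⟨w', hw', h'⟩ := h'
  refine ⟨w.append w', by rw [Walk.length_append]; omega, fun v hv => ?_⟩
  rcases (Walk.mem_support_append_iff _ _).1 hv with hv | hv
  exacts [h v hv, h' v hv]

theorem Near.mono {G : SimpleGraph V} {L : Set V} {t t' : ℕ} (ht : t ≤ t') {x y : V}
    (h : Near G L t x y) : Near G L t' x y := by
  obtain ⟨w, hw, h⟩ := h
  exact ⟨w, hw.trans ht, h⟩

theorem near_of_mem_ball {G : SimpleGraph V} {L F : Set V} {r : ℕ} {z y : V} (hF : ∀ x ∈ F, x ∉ L)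
    (hz : z ∉ L) (h : y ∈ ball G F {z} r) : Near G L r z y := by
  obtain ⟨x, rfl, w, hw, h⟩ := exists_walk_of_mem_ball h
  refine ⟨w, hw, fun v hv => ?_⟩
  rcases h v hv with rfl | h
  exacts [hz, hF v h]

theorem Near.mem_ball {G : SimpleGraph V} {L X : Set V} {r : ℕ} {x y : V} (hx : x ∈ X)
    (h : Near G L r x y) : y ∈ ball G Lᶜ X r := by
  obtain ⟨w, hw, h⟩ := h
  exact mem_ball_of_walk w hx (fun v hv => Or.inr (h v hv)) hw

/-- In an expander, not all of many far apart points have small balls after the removal of a small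
set. -/
theorem exists_large_ball [Fintype V] {G : SimpleGraph V} {ε K η : ℝ}
    (hG : Expands G ε K) {L S : Set V} {ρ s N : ℕ} (hη : 0 ≤ η) (hs : (s : ℝ) ≤ (1 + η) ^ ρ)
    (hKN : K ≤ N) (hNs : ((N * s : ℕ) : ℝ) ≤ Fintype.card V / 2)
    (hgap : ∀ x : ℝ, N ≤ x → x ≤ (N * s : ℕ) →
      ((L ∪ S).ncard : ℝ) + η * x < ε * x / Real.log x ^ 2)
    {Z : Finset V} (hZ : Z.card = N) (hZL : ∀ z ∈ Z, z ∉ L)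
    (hfar : ∀ z ∈ Z, ∀ z' ∈ Z, z ≠ z' → ¬ Near G L (2 * ρ) z z') :
    ∃ z ∈ Z, s ≤ (ball G (L ∪ S)ᶜ {z} ρ).ncard := by
  classical
  by_contra! hcon
  -- If all balls are small, stop each at a radius where it grows by a factor of at most 1 + η.
  -- These balls are disjoint by distance, and their union has too few neighbours for the expansion,
  -- by `hgap`.
  have hrad : ∀ z ∈ Z, ∃ r < ρ, ((nbhd G (ball G (L ∪ S)ᶜ {z} r) ∩ (L ∪ S)ᶜ).ncard : ℝ) ≤
      η * (ball G (L ∪ S)ᶜ {z} r).ncard := fun z hz => exists_slow_radius hη hs (hcon z hz)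
  choose! rad hrad using hrad
  set B : V → Finset V := fun z => (ball G (L ∪ S)ᶜ {z} (rad z)).toFinset with hB
  have hmemB : ∀ z y, y ∈ B z ↔ y ∈ ball G (L ∪ S)ᶜ {z} (rad z) := fun z y => Set.mem_toFinset
  have hBcard : ∀ z, (B z).card = (ball G (L ∪ S)ᶜ {z} (rad z)).ncard := fun z =>
    (Set.ncard_eq_toFinset_card' _).symm
  have hnear : ∀ z ∈ Z, ∀ y ∈ B z, Near G L ρ z y := fun z hz y hy =>
    (near_of_mem_ball (fun x (hx : x ∈ (L ∪ S)ᶜ) hL => hx (Or.inl hL)) (hZL z hz) ((hmemB z y).1 hy)).mono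
      (hrad z hz).1.le
  have hdisj : (Z : Set V).PairwiseDisjoint B := by
    intro z hz z' hz' hne
    rw [Function.onFun, Finset.disjoint_left]
    intro y hy hy'
    refine hfar z hz z' hz' hne ?_
    rw [two_mul]
    exact (hnear z hz y hy).trans (hnear z' hz' y hy').symm
  set X : Finset V := Z.biUnion B with hX
  have hXcard : X.card = ∑ z ∈ Z, (B z).card := Finset.card_biUnion hdisj
  have hXN : N ≤ X.card := by
    rw [hXcard, ← hZ, Finset.card_eq_sum_ones]
    refine Finset.sum_le_sum fun z _ => Finset.card_pos.2 ⟨z, (hmemB z z).2 ?_⟩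
    exact ball_mono _ _ _ (Nat.zero_le _) rfl
  have hXs : X.card ≤ N * s := by
    rw [← hZ]
    refine Finset.card_biUnion_le_card_mul _ _ _ fun z hz => ?_
    rw [hBcard]
    exact (Set.ncard_le_ncard (ball_mono _ _ _ (hrad z hz).1.le)).trans (hcon z hz).le
  have hXN' : (N:ℝ) ≤ X.card := by exact_mod_cast hXN
  have hXs' : (X.card:ℝ) ≤ (N * s : ℕ) := by exact_mod_cast hXs
  have h1 := hG (X : Set V) (by rw [Set.ncard_coe_finset]; linarith)
    (by rw [Set.ncard_coe_finset]; linarith)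
  rw [Set.ncard_coe_finset] at h1
  have hsub : nbhd G (X : Set V) ⊆ (L ∪ S) ∪ (Z.biUnion fun z =>
      (nbhd G (ball G (L ∪ S)ᶜ {z} (rad z)) ∩ (L ∪ S)ᶜ).toFinset : Finset V) := by
    rintro y ⟨hyX, x, hx, hxy⟩
    by_cases hyL : y ∈ L ∪ S
    · exact Or.inl hyL
    · right
      obtain ⟨z, hz, hxz⟩ := Finset.mem_biUnion.1 hx
      simp only [Finset.coe_biUnion, Set.coe_toFinset, Set.mem_iUnion]
      refine ⟨z, hz, ⟨fun hy => hyX ?_, x, (hmemB z x).1 hxz, hxy⟩, hyL⟩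
      exact Finset.mem_biUnion.2 ⟨z, hz, (hmemB z y).2 hy⟩
  have h2 := (Set.ncard_le_ncard hsub).trans (Set.ncard_union_le _ _)
  rw [Set.ncard_coe_finset] at h2
  have h3 : ((nbhd G (X : Set V)).ncard : ℝ) ≤ (L ∪ S).ncard + η * X.card := by
    have h4 : ((nbhd G (X : Set V)).ncard : ℝ) ≤ (L ∪ S).ncard + ∑ z ∈ Z,
        ((nbhd G (ball G (L ∪ S)ᶜ {z} (rad z)) ∩ (L ∪ S)ᶜ).ncard : ℝ) := by
      have := h2.trans (Nat.add_le_add_left Finset.card_biUnion_le _)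
      simp only [← Set.ncard_eq_toFinset_card'] at this
      exact_mod_cast this
    refine h4.trans (add_le_add_right ?_ _)
    rw [hXcard]
    push_cast
    rw [Finset.mul_sum]
    refine Finset.sum_le_sum fun z hz => ?_
    rw [hBcard]
    exact (hrad z hz).2
  have h4 := hgap X.card hXN' hXs'
  linarith

/-- Many far apart connected sets of size `s` away from `L` and `S`. -/
theorem exists_cells [Fintype V] {G : SimpleGraph V} {ε K η : ℝ}
    (hG : Expands G ε K) {L S : Set V} {ρ s N Δ : ℕ} (hη : 0 ≤ η) (hs : (s : ℝ) ≤ (1 + η) ^ ρ)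
    (hs1 : 1 ≤ s)
    (hKN : K ≤ N) (hNs : ((N * s : ℕ) : ℝ) ≤ Fintype.card V / 2)
    (hgap : ∀ x : ℝ, N ≤ x → x ≤ (N * s : ℕ) →
      ((L ∪ S).ncard : ℝ) + η * x < ε * x / Real.log x ^ 2)
    (hΔ : ∀ x, x ∉ L → (G.neighborSet x).ncard ≤ Δ)
    (hcard : (2 * N + S.ncard) * (Δ + 1) ^ (4 * ρ) + (L ∪ S).ncard ≤ Fintype.card V) :
    ∃ (Z : Finset V) (A : V → Finset V), Z.card = N ∧
      (∀ z ∈ Z, z ∈ A z ∧ (A z).card = s ∧ (∀ a ∈ A z, a ∉ L ∪ S) ∧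
        ∀ a ∈ A z, ∃ w : G.Walk z a, w.length ≤ ρ ∧ ∀ x ∈ w.support, x ∈ A z) ∧
      (∀ z ∈ Z, ∀ z' ∈ Z, z ≠ z' → ∀ a ∈ A z, ∀ a' ∈ A z', ¬ Near G L ρ a a') ∧
      (∀ v ∈ S, v ∉ L → ∀ z ∈ Z, ∀ a ∈ A z, ¬ Near G L ρ v a) := by
  classical
  -- Separation 4ρ between centres, and from S, leaves distance more than ρ between cells of radius
  -- ρ, and from cells to S.
  set P : Set V := ((L ∪ S) ∪ ball G Lᶜ (S \ L) (4 * ρ))ᶜ with hP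
  have hPcard : 2 * N * (Δ + 1) ^ (4 * ρ) ≤ P.ncard := by
    have h1 := Set.ncard_add_ncard_compl ((L ∪ S) ∪ ball G Lᶜ (S \ L) (4 * ρ))
    rw [Nat.card_eq_fintype_card, ← hP] at h1
    have h2 := Set.ncard_union_le (L ∪ S) (ball G Lᶜ (S \ L) (4 * ρ))
    have h3 := ncard_ball_le (G := G) (F := Lᶜ) (X := S \ L) (Δ := Δ)
      (by rintro x (hx | hx); exacts [hΔ x hx.2, hΔ x hx]) (4 * ρ)
    have h4 : (S \ L).ncard ≤ S.ncard := Set.ncard_le_ncard Set.sdiff_subset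
    have h5 := Nat.mul_le_mul_right ((Δ + 1) ^ (4 * ρ)) h4
    rw [Nat.add_mul] at hcard
    omega
  have hPL : ∀ z ∈ P, z ∉ L := fun z hz hL => hz (Or.inl (Or.inl hL))
  have hrel : ∀ z ∈ P, {z' | z' = z ∨ Near G L (4 * ρ) z z'}.ncard ≤ (Δ + 1) ^ (4 * ρ) := by
    intro z hz
    have h1 := ncard_ball_le (G := G) (F := Lᶜ) (X := {z}) (Δ := Δ)
      (by rintro x (rfl | hx); exacts [hΔ _ (hPL _ hz), hΔ x hx]) (4 * ρ)
    rw [Set.ncard_singleton, one_mul] at h1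
    refine (Set.ncard_le_ncard ?_).trans h1
    rintro y (rfl | hy)
    · exact ball_mono _ _ _ (Nat.zero_le _) rfl
    · exact hy.mem_ball rfl
  obtain ⟨Z, hZcard, hZP, hZ⟩ := exists_pairwise_unrelated
    (rel := fun z z' => z' = z ∨ Near G L (4 * ρ) z z') (fun z => Or.inl rfl)
    (fun z z' h => h.imp Eq.symm Near.symm) (by positivity) hrel (2 * N) hPcard
  have hZfar : ∀ z ∈ Z, ∀ z' ∈ Z, z ≠ z' → ¬ Near G L (4 * ρ) z z' := fun z hz z' hz' hne h =>
    hZ z hz z' hz' hne (Or.inr h)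
  set good : Finset V := Z.filter fun z => s ≤ (ball G (L ∪ S)ᶜ {z} ρ).ncard with hgood
  have hgoodN : N ≤ good.card := by
    -- Twice as many centres as needed were chosen: otherwise N of them have small balls, contrary
    -- to `exists_large_ball`.
    by_contra! hlt
    have h1 := Finset.card_filter_add_card_filter_not (s := Z)
      (fun z => s ≤ (ball G (L ∪ S)ᶜ {z} ρ).ncard)
    rw [← hgood] at h1
    obtain ⟨Z', hZ', hZ'card⟩ := Finset.exists_subset_card_eq
      (s := Z.filter fun z => ¬ s ≤ (ball G (L ∪ S)ᶜ {z} ρ).ncard) (n := N) (by omega)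
    have hZZ : ∀ z ∈ Z', z ∈ Z := fun z hz => (Finset.mem_filter.1 (hZ' hz)).1
    obtain ⟨z, hz, hsz⟩ := exists_large_ball hG (L := L) (S := S) hη hs hKN hNs hgap hZ'card
      (fun z hz => hPL z (hZP (hZZ z hz)))
      (fun z hz z' hz' hne h => hZfar z (hZZ z hz) z' (hZZ z' hz') hne (h.mono (by omega)))
    exact (Finset.mem_filter.1 (hZ' hz)).2 hsz
  obtain ⟨Z', hZ', hZ'card⟩ := Finset.exists_subset_card_eq hgoodN
  have hZZ : ∀ z ∈ Z', z ∈ Z := fun z hz => (Finset.mem_filter.1 (hZ' hz)).1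
  have hcell : ∀ z ∈ Z', ∃ A : Finset V, A.card = s ∧ z ∈ A ∧
      (A : Set V) ⊆ ball G (L ∪ S)ᶜ {z} ρ ∧
      ∀ a ∈ A, ∃ w : G.Walk z a, w.length ≤ ρ ∧ ∀ x ∈ w.support, x ∈ A := fun z hz =>
    exists_cell hs1 (Finset.mem_filter.1 (hZ' hz)).2
  choose! A hA using hcell
  have hnear : ∀ z ∈ Z', ∀ a ∈ A z, Near G L ρ z a := fun z hz a ha =>
    near_of_mem_ball (fun x (hx : x ∈ (L ∪ S)ᶜ) hL => hx (Or.inl hL)) (hPL z (hZP (hZZ z hz)))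
      ((hA z hz).2.2.1 ha)
  refine ⟨Z', A, hZ'card, fun z hz => ⟨(hA z hz).2.1, (hA z hz).1, fun a ha => ?_,
    (hA z hz).2.2.2⟩, fun z hz z' hz' hne a ha a' ha' hn => ?_, fun v hv hvL z hz a ha hn => ?_⟩
  · rcases ball_subset _ _ _ _ ((hA z hz).2.2.1 ha) with rfl | h
    · exact fun h => hZP (hZZ a hz) (Or.inl h)
    · exact h
  · exact hZfar z (hZZ z hz) z' (hZZ z' hz') hne
      ((((hnear z hz a ha).trans hn).trans (hnear z' hz' a' ha').symm).mono (by omega))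
  · refine hZP (hZZ z hz) (Or.inr ?_)
    exact ((hn.trans (hnear z hz a ha).symm).mono (by omega)).mem_ball ⟨hv, hvL⟩

end KrakenLemma

/-! ### Assembling the kraken -/

namespace KrakenLemma

variable {V : Type*}

/-- Many disjoint sets of size `t` avoiding `W` in large sets. -/
theorem exists_disjoint_subsets [DecidableEq V] {I : Type*} [Fintype I] {N : I → Finset V}
    {W : Finset V} {t : ℕ} (h : ∀ e, W.card + Fintype.card I * t ≤ (N e).card) :
    ∃ B : I → Finset V, (∀ e, (B e).card = t) ∧ (∀ e, B e ⊆ N e \ W) ∧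
      ∀ e e', e ≠ e' → Disjoint (B e) (B e') := by
  -- Hall's theorem with t copies of each index: even a single set N e \ W is as large as the number
  -- of all copies.
  obtain ⟨f, hf, hfN⟩ := (Finset.all_card_le_biUnion_card_iff_exists_injective
    (fun p : I × Fin t => N p.1 \ W)).1 (by
      intro S
      rcases S.eq_empty_or_nonempty with rfl | ⟨p, hp⟩
      · simp
      · have h1 : S.card ≤ Fintype.card I * t := by
          simpa using Finset.card_le_univ S
        have h2 := Finset.card_le_card (Finset.subset_biUnion_of_mem
          (fun p : I × Fin t => N p.1 \ W) hp)
        have h3 := Finset.le_card_sdiff W (N p.1)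
        have h4 := h p.1
        omega)
  refine ⟨fun e => Finset.univ.image fun j => f (e, j), fun e => ?_, fun e x hx => ?_,
    fun e e' hne => Finset.disjoint_left.2 fun x hx hx' => ?_⟩
  · rw [Finset.card_image_of_injective _ fun i j hij => (Prod.mk.inj (hf hij)).2, Finset.card_univ,
      Fintype.card_fin]
  · obtain ⟨j, -, rfl⟩ := Finset.mem_image.1 hx
    exact hfN (e, j)
  · obtain ⟨j, -, rfl⟩ := Finset.mem_image.1 hx
    obtain ⟨j', -, hj⟩ := Finset.mem_image.1 hx'
    exact hne (Prod.mk.inj (hf hj)).1.symm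

theorem diamAtMost_induce {G : SimpleGraph V} {A : Set V} {z : V} {r : ℕ} {t : ℝ}
    (h : ∀ a ∈ A, ∃ w : G.Walk z a, w.length ≤ r ∧ ∀ x ∈ w.support, x ∈ A)
    (ht : (2 * r : ℝ) ≤ t) : DiamAtMost (G.induce A) t := by
  rintro ⟨x, hx⟩ ⟨y, hy⟩
  obtain ⟨p, hp, hpA⟩ := h x hx
  obtain ⟨q, hq, hqA⟩ := h y hy
  have hs : ∀ v ∈ (p.reverse.append q).support, v ∈ A := fun v hv => by
    rcases (Walk.mem_support_append_iff _ _).1 hv with hv | hv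
    exacts [hpA v (by simpa using hv), hqA v hv]
  refine ⟨(p.reverse.append q).induce A hs, le_trans ?_ ht⟩
  have hl : ((p.reverse.append q).induce A hs).length = p.length + q.length := by
    have h1 := congrArg List.length (Walk.support_induce (p.reverse.append q) hs)
    rw [List.length_attachWith, Walk.length_support, Walk.length_support, Walk.length_append,
      Walk.length_reverse] at h1
    exact Nat.succ_injective h1
  rw [hl]
  exact_mod_cast (show p.length + q.length ≤ 2 * r by omega)

/-- A complete family of arms and sets at the far targets give a kraken. -/
theorem exists_kraken [Fintype V] {G : SimpleGraph V} {k s : ℕ} {m : ℝ} (hk : 3 ≤ k) (hs : 1 ≤ s)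
    (C : Copy (cycleGraph k) G) {Φ : Frame V (Fin k × Fin 2)} (hcore : Φ.core = Set.range C)
    (hstart : ∀ e, Φ.start e = C e.1) (hTC : ∀ t ∈ Φ.T, t ∉ Φ.core)
    {F : Fin k × Fin 2 → Option (Arm G)} (hF : Φ.IsFamily F) {b : Fin k × Fin 2 → Arm G}
    (hb : ∀ e, F e = some (b e)) {L : Set V} {r : ℕ} (hr : 1 ≤ r) (hrm : (2 * r : ℝ) ≤ m)
    (hM : (Φ.M : ℝ) ≤ 10 * m)
    (hL : ∀ l ∈ L, k + 2 * k * Φ.M + 4 * k * s ≤ (G.neighborSet l).ncard)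
    (hcell : ∀ t ∈ Φ.T, t ∉ L → ∃ A : Finset V, A.card = s ∧ t ∈ A ∧
      (∀ a ∈ A, a ∈ Φ.T ∧ Φ.lab a = Φ.lab t) ∧
      ∃ z, ∀ a ∈ A, ∃ w : G.Walk z a, w.length ≤ r ∧ ∀ x ∈ w.support, x ∈ A) :
    ∃ K : Kraken G k m s, ∀ i j, K.u i j = (b (i, j)).lst := by
  classical
  have hI : Fintype.card (Fin k × Fin 2) = 2 * k := by simp [mul_comm]
  have hA := fun e => hF.isArm e (b e) (hb e)
  have hAd := fun e e' (hne : e ≠ e') => hF.disj e e' _ _ hne (hb e) (hb e')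
  have hadj : ∀ e, G.Adj (C e.1) (b e).fst := fun e => by rw [← hstart]; exact (hA e).adj
  have hlst : ∀ e, (b e).lst ∈ (b e).verts := fun e => (b e).walk.end_mem_support
  have hcell' : ∀ e, ∃ A : Finset V, (b e).lst ∉ L → (A.card = s ∧ (b e).lst ∈ A ∧
      (∀ a ∈ A, a ∈ Φ.T ∧ Φ.lab a = Φ.lab (b e).lst) ∧
      ∃ z, ∀ a ∈ A, ∃ w : G.Walk z a, w.length ≤ r ∧ ∀ x ∈ w.support, x ∈ A) := fun e => by
    by_cases h : (b e).lst ∈ L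
    · exact ⟨∅, fun h' => absurd h h'⟩
    · obtain ⟨A, hA⟩ := hcell _ (hA e).lst_mem h
      exact ⟨A, fun _ => hA⟩
  choose A' hA' using hcell'
  set cells : Finset V := Finset.univ.biUnion fun e => if (b e).lst ∈ L then ∅ else A' e
    with hcells
  have hcells_card : cells.card ≤ 2 * k * s := by
    rw [← hI, ← Finset.card_univ]
    refine Finset.card_biUnion_le_card_mul _ _ _ fun e _ => ?_
    split_ifs with h
    · simp
    · exact (hA' e h).1.le
  set W : Finset V := (Φ.core ∪ occupied F).toFinset ∪ cells with hW
  have hWcard : W.card ≤ k + 2 * k * Φ.M + 2 * k * s := by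
    have h1 := Finset.card_union_le (Φ.core ∪ occupied F).toFinset cells
    rw [← Set.ncard_eq_toFinset_card', ← hW] at h1
    have h2 := Set.ncard_union_le Φ.core (occupied F)
    have h3 : Φ.core.ncard = k := by rw [hcore, ncard_range_copy]
    have h4 := (Set.ncard_le_ncard (occupied_subset_lowSet hF)).trans
      (ncard_lowSet_le F (Φ.M - 1))
    have h5 : 1 ≤ Φ.M := by
      have := (hA (⟨0, by omega⟩, 0)).length_le
      omega
    rw [hI, Nat.sub_add_cancel h5] at h4
    omega
  have hWcore : ∀ x ∈ Φ.core, x ∈ W := fun x hx =>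
    Finset.mem_union_left _ (Set.mem_toFinset.2 (Or.inl hx))
  have hWverts : ∀ e, ∀ x ∈ (b e).verts, x ∈ W := fun e x hx =>
    Finset.mem_union_left _ (Set.mem_toFinset.2 (Or.inr ⟨e, b e, hb e, hx⟩))
  have hWcell : ∀ e, (b e).lst ∉ L → ∀ x ∈ A' e, x ∈ W := fun e h x hx =>
    Finset.mem_union_right _ (Finset.mem_biUnion.2 ⟨e, by simp, by rwa [if_neg h]⟩)
  let N : {e : Fin k × Fin 2 // (b e).lst ∈ L} → Finset V := fun e =>
    (G.neighborSet (b e.1).lst).toFinset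
  -- An end in L becomes the centre of a star with s - 1 leaves. In `hL`, half of the term 4ks pays
  -- for the cells inside W and half for the disjoint choice of leaves.
  obtain ⟨B, hBcard, hBN, hBdisj⟩ := exists_disjoint_subsets (N := N) (W := W) (t := s - 1) (by
    intro e
    have h1 := hL _ e.2
    have h2 : Fintype.card {e : Fin k × Fin 2 // (b e).lst ∈ L} ≤ 2 * k := by
      rw [← hI]; exact Fintype.card_subtype_le _
    have h3 : Fintype.card {e : Fin k × Fin 2 // (b e).lst ∈ L} * (s - 1) ≤ 2 * k * s :=
      Nat.mul_le_mul h2 (Nat.sub_le _ _)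
    simp only [N, ← Set.ncard_eq_toFinset_card']
    have h4 : 4 * k * s = 2 * k * s + 2 * k * s := by ring
    omega)
  have hBadj : ∀ e x, x ∈ B e → G.Adj (b e.1).lst x ∧ x ∉ W := fun e x hx => by
    have := Finset.mem_sdiff.1 (hBN e hx)
    exact ⟨by simpa [N] using this.1, this.2⟩
  let A : Fin k × Fin 2 → Finset V := fun e =>
    if h : (b e).lst ∈ L then insert (b e).lst (B ⟨e, h⟩) else A' e
  have hA1 : ∀ e (h : (b e).lst ∈ L), A e = insert (b e).lst (B ⟨e, h⟩) := fun e h => dif_pos h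
  have hA2 : ∀ e (h : (b e).lst ∉ L), A e = A' e := fun e h => dif_neg h
  have hmemA : ∀ e x, x ∈ A e → x = (b e).lst ∨
      (∃ h : (b e).lst ∈ L, x ∈ B ⟨e, h⟩) ∨ ((b e).lst ∉ L ∧ x ∈ A' e) := fun e x hx => by
    by_cases h : (b e).lst ∈ L
    · rw [hA1 e h] at hx
      rcases Finset.mem_insert.1 hx with hx | hx
      exacts [Or.inl hx, Or.inr (Or.inl ⟨h, hx⟩)]
    · rw [hA2 e h] at hx
      exact Or.inr (Or.inr ⟨h, hx⟩)
  have hA_core : ∀ e, ∀ x ∈ A e, x ∉ Φ.core := by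
    intro e x hx hc
    rcases hmemA e x hx with rfl | ⟨h, hx⟩ | ⟨h, hx⟩
    · exact hTC _ (hA e).lst_mem hc
    · exact (hBadj _ x hx).2 (hWcore x hc)
    · exact hTC x ((hA' e h).2.2.1 x hx).1 hc
  have hA_verts : ∀ e e', e ≠ e' → ∀ x ∈ A e', x ∈ (b e).verts → x = (b e).lst := by
    intro e e' hne x hx hxb
    rcases hmemA e' x hx with rfl | ⟨h, hx⟩ | ⟨h, hx⟩
    · exact absurd (hlst e') (Set.disjoint_left.1 (hAd e e' hne).1 hxb)
    · exact absurd (hWverts e x hxb) (hBadj _ x hx).2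
    · exact (hA e).eq_lst x hxb ((hA' e' h).2.2.1 x hx).1
  have hA_disj : ∀ e e', e ≠ e' → Disjoint (A e) (A e') := by
    intro e e' hne
    rw [Finset.disjoint_left]
    intro x hx hx'
    have hWA : ∀ e x, x ∈ A e → (b e).lst ∉ L ∨ x = (b e).lst → x ∈ W := by
      intro e x hx h
      rcases h with h | rfl
      · rw [hA2 e h] at hx; exact hWcell e h x hx
      · exact hWverts e _ (hlst e)
    rcases hmemA e x hx with h1 | ⟨h1, hx1⟩ | ⟨h1, hx1⟩ <;>
      rcases hmemA e' x hx' with h2 | ⟨h2, hx2⟩ | ⟨h2, hx2⟩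
    · exact Set.disjoint_left.1 (hAd e e' hne).1 (hlst e) (h1 ▸ h2 ▸ hlst e')
    · exact (hBadj _ x hx2).2 (hWA e x hx (Or.inr h1))
    · exact (hAd e e' hne).2 (h1 ▸ ((hA' e' h2).2.2.1 x hx2).2)
    · exact (hBadj _ x hx1).2 (hWA e' x hx' (Or.inr h2))
    · exact Finset.disjoint_left.1 (hBdisj ⟨e, h1⟩ ⟨e', h2⟩ (fun h => hne (Subtype.mk.inj h))) hx1
        hx2
    · exact (hBadj _ x hx1).2 (hWA e' x hx' (Or.inl h2))
    · exact (hAd e e' hne).2 (h2 ▸ ((hA' e h1).2.2.1 x hx1).2).symm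
    · exact (hBadj _ x hx2).2 (hWA e x hx (Or.inl h1))
    · exact (hAd e e' hne).2 (((hA' e h1).2.2.1 x hx1).2.symm.trans
        ((hA' e' h2).2.2.1 x hx2).2)
  -- Arms of a family are walks and may repeat vertices, so repetitions are removed here.
  let R : ∀ e : Fin k × Fin 2, G.Walk (C e.1) (b e).lst := fun e =>
    (Walk.cons (hadj e) (b e).walk).bypass
  have hRsupp : ∀ e x, x ∈ (R e).support → x = C e.1 ∨ x ∈ (b e).verts := fun e x hx => by
    have := (Walk.cons (hadj e) (b e).walk).support_bypass_subset_support hx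
    rw [Walk.support_cons, List.mem_cons] at this
    exact this
  have hRint : ∀ e x, x ∈ internalVerts (R e) → x ∈ (b e).verts ∧ x ≠ (b e).lst := fun e x hx =>
    ⟨(hRsupp e x hx.1).resolve_left hx.2.1, hx.2.2⟩
  refine ⟨{
    three_le := hk
    C := C
    u := fun i j => (b (i, j)).lst
    A := fun i j => A (i, j)
    R := fun i j => R (i, j)
    u_mem := fun i j => ?_
    card_A := fun i j => ?_
    A_disjoint_cycle := fun i j l h => hA_core (i, j) _ h (by rw [hcore]; exact ⟨l, rfl⟩)
    A_disjoint := fun i j i' j' hne => hA_disj _ _ hne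
    A_diam := fun i j => ?_
    R_isPath := fun i j => Walk.bypass_isPath _
    R_length := fun i j => ?_
    R_disjoint_cycle := fun i j l h =>
      (hA (i, j)).avoid _ (hRint _ _ h).1 (by rw [hcore]; exact ⟨l, rfl⟩)
    R_disjoint_A := fun i j i' j' hne x hx hxA =>
      (hRint _ _ hx).2 (hA_verts _ _ hne x hxA (hRint _ _ hx).1)
    R_disjoint := fun i j i' j' hne x hx hx' => ?_ }, fun i j => rfl⟩
  · by_cases h : (b (i, j)).lst ∈ L
    · rw [hA1 _ h]; exact Finset.mem_insert_self _ _
    · rw [hA2 _ h]; exact (hA' _ h).2.1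
  · by_cases h : (b (i, j)).lst ∈ L
    · rw [hA1 _ h, Finset.card_insert_of_notMem fun hm =>
        (hBadj _ _ hm).2 (hWverts _ _ (hlst _)), hBcard]
      omega
    · rw [hA2 _ h]; exact (hA' _ h).1
  · by_cases h : (b (i, j)).lst ∈ L
    · refine diamAtMost_induce (z := (b (i, j)).lst) (r := r) (fun a ha => ?_) hrm
      rw [hA1 _ h] at ha ⊢
      rcases Finset.mem_insert.1 ha with rfl | ha
      · exact ⟨.nil, by simp, by simp⟩
      · refine ⟨(hBadj _ a ha).1.toWalk, by simpa using hr, ?_⟩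
        simp [ha]
    · obtain ⟨z, hz⟩ := (hA' _ h).2.2.2
      rw [hA2 _ h]
      exact diamAtMost_induce hz hrm
  · have h1 := (Walk.cons (hadj (i, j)) (b (i, j)).walk).length_bypass_le_length
    have h2 := (hA (i, j)).length_le
    rw [Walk.length_cons] at h1
    refine le_trans ?_ hM
    exact_mod_cast h1.trans h2
  · have h1 := (hRint _ _ hx).1
    rcases hRsupp _ x hx' with rfl | h2
    · exact (hA _).avoid _ h1 (by rw [hcore]; exact ⟨_, rfl⟩)
    · exact Set.disjoint_left.1 (hAd _ _ hne).1 h1 h2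

end KrakenLemma

/-! ### The two choices of targets -/

namespace KrakenLemma

variable {V : Type*} {k : ℕ} {G : SimpleGraph V} {L : Set V} {C : Copy (cycleGraph k) G}

/-- The targets of a linking problem from the cycle `C`: they are separated and rich, and each
target outside `L` lies in a cell of `s` targets of small radius with its label. -/
structure GoodFrame [Fintype V] (G : SimpleGraph V) (C : Copy (cycleGraph k) G) (L : Set V)
    (ρ s M : ℕ) (K ℓ : ℝ) (Φ : Frame V (Fin k × Fin 2)) : Prop where
  core_eq : Φ.core = Set.range C
  start_eq : ∀ e, Φ.start e = C e.1
  M_eq : Φ.M = M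
  sep : Φ.Separated G L ρ
  fiber : ∀ a, {t | t ∈ Φ.T ∧ Φ.lab t = a}.ncard ≤ s
  rich : Φ.Rich G (2 * k) K ℓ
  cell : ∀ t ∈ Φ.T, t ∉ L → ∃ A : Finset V, A.card = s ∧ t ∈ A ∧
      (∀ a ∈ A, a ∈ Φ.T ∧ Φ.lab a = Φ.lab t) ∧
      ∃ z, ∀ a ∈ A, ∃ w : G.Walk z a, w.length ≤ ρ ∧ ∀ x ∈ w.support, x ∈ A

/-- All targets lie in L, so the conditions on other targets are vacuous. Richness holds as |L| >
3k: some vertex of L off the cycle is unused, and most of its neighbours avoid `W`. -/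
theorem exists_goodFrame_of_many [Fintype V] {ρ s M D : ℕ} {ℓ : ℝ} (hs : 1 ≤ s) (hρM : ρ ≤ M)
    (hℓ : 2 ≤ ℓ)
    (hD : ∀ x, D ≤ (G.neighborSet x).ncard)
    (hdegL : ∀ l ∈ L, ℓ ^ 100 ≤ ((G.neighborSet l).ncard : ℝ)) (hL : 2 * ℓ < L.ncard)
    (hk : (k : ℝ) ≤ ℓ / 4) :
    ∃ Φ : Frame V (Fin k × Fin 2), GoodFrame G C L ρ s M (D / 2) ℓ Φ ∧ ∀ t ∈ Φ.T, t ∈ L := by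
  refine ⟨⟨Set.range C, L \ Set.range C, id, M, fun e => C e.1⟩, ⟨rfl, fun _ => rfl, rfl,
    ⟨fun e => ⟨e.1, rfl⟩, fun t ht => ht.2, fun l hl hc => ⟨hl, hc⟩, fun l _ _ t _ h => h,
      fun v _ _ t ht htL => absurd ht.1 htL, hρM⟩, fun a => ?_, ?_, fun t ht htL =>
      absurd ht.1 htL⟩, fun t ht => ht.1⟩
  · refine le_trans ?_ hs
    rw [Set.ncard_le_one]
    rintro x ⟨-, hx⟩ y ⟨-, hy⟩
    exact (show x = a from hx).trans (show y = a from hy).symm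
  · intro W U _ hW hU hWT
    have h1 : L.ncard ≤ (L \ Set.range C).ncard + k := by
      have h := Set.ncard_le_ncard_sdiff_add_ncard L (Set.range C)
      rwa [ncard_range_copy C] at h
    have h2 : U.ncard < (L \ Set.range C).ncard := by
      have h3 : 3 * k < L.ncard := by
        have : (3 * k : ℝ) < L.ncard := by linarith
        exact_mod_cast this
      omega
    obtain ⟨l, hl, hlU⟩ := Set.exists_mem_notMem_of_ncard_lt_ncard h2
    refine ⟨G.neighborSet l \ W, ?_⟩
    have h4 := hdegL l hl.1
    have h5 : (D : ℝ) ≤ (G.neighborSet l).ncard := by exact_mod_cast hD l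
    have h6 : ((G.neighborSet l).ncard : ℝ) ≤ (G.neighborSet l \ W).ncard + W.ncard := by
      exact_mod_cast Set.ncard_le_ncard_sdiff_add_ncard _ _
    have h7 : ℓ ^ 12 ≤ ℓ ^ 15 := pow_le_pow_right₀ (by linarith) (by norm_num)
    have h8 : 4 * ℓ ^ 15 ≤ ℓ ^ 100 := by
      have h9 : (4:ℝ) ≤ ℓ ^ 2 := by nlinarith
      calc 4 * ℓ ^ 15 ≤ ℓ ^ 2 * ℓ ^ 15 := by gcongr
        _ = ℓ ^ 17 := by ring
        _ ≤ ℓ ^ 100 := pow_le_pow_right₀ (by linarith) (by norm_num)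
    have h9 : 0 ≤ ℓ ^ 15 := by positivity
    exact ⟨by linarith, by linarith, Set.disjoint_left.2 fun x hx => hx.2,
      fun y hy => Or.inr ⟨l, hl, hlU, hy.1.symm⟩⟩

/-- The label of a vertex in a cell is the centre of the cell, and other vertices label themselves.
Richness comes from the number of cells: fewer than 2k are spoilt, and the rest are disjoint and
avoid `W` altogether. -/
theorem exists_goodFrame_of_cells [Fintype V] {ρ s M N : ℕ} {K ℓ : ℝ} (hs : 1 ≤ s) (hρM : ρ ≤ M)
    {Z : Finset V} {A : V → Finset V} (hZ : Z.card = N)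
    (hA : ∀ z ∈ Z, z ∈ A z ∧ (A z).card = s ∧ (∀ a ∈ A z, a ∉ L ∪ Set.range C) ∧
        ∀ a ∈ A z, ∃ w : G.Walk z a, w.length ≤ ρ ∧ ∀ x ∈ w.support, x ∈ A z)
    (hfar : ∀ z ∈ Z, ∀ z' ∈ Z, z ≠ z' → ∀ a ∈ A z, ∀ a' ∈ A z', ¬ Near G L ρ a a')
    (hfarC : ∀ v ∈ Set.range C, v ∉ L → ∀ z ∈ Z, ∀ a ∈ A z, ¬ Near G L ρ v a)
    (hK : K + 2 * k ≤ N) (hℓN : ℓ ^ 15 + 2 * k ≤ N) :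
    ∃ Φ : Frame V (Fin k × Fin 2), GoodFrame G C L ρ s M K ℓ Φ ∧
      ∀ t ∈ Φ.T, ∀ t' ∈ Φ.T, t ∉ L → t' ∉ L → Φ.lab t ≠ Φ.lab t' → ¬ Near G L ρ t t' := by
  classical
  have hlab : ∀ x, ∃ y, (∀ z ∈ Z, x ∈ A z → y = z) ∧ ((∀ z ∈ Z, x ∉ A z) → y = x) := by
    intro x
    by_cases h : ∃ z ∈ Z, x ∈ A z
    · obtain ⟨z, hz, hx⟩ := h
      refine ⟨z, fun z' hz' hx' => ?_, fun h => absurd hx (h z hz)⟩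
      -- Cells are disjoint, since a common vertex would join two of them by the trivial walk.
      by_contra hne
      exact hfar z hz z' hz' hne x hx x hx' ⟨.nil, by simp, by
        simpa using fun h => (hA z hz).2.2.1 x hx (Or.inl h)⟩
    · push Not at h
      exact ⟨x, fun z hz hx => absurd hx (h z hz), fun _ => rfl⟩
  choose lab hlab1 hlab2 using hlab
  have hAL : ∀ z ∈ Z, ∀ a ∈ A z, a ∉ L := fun z hz a ha h => (hA z hz).2.2.1 a ha (Or.inl h)
  have hAC : ∀ z ∈ Z, ∀ a ∈ A z, a ∉ Set.range C := fun z hz a ha h =>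
    (hA z hz).2.2.1 a ha (Or.inr h)
  have hlabL : ∀ l ∈ L, lab l = l := fun l hl => hlab2 l fun z hz h => hAL z hz l h hl
  let T : Set V := (L \ Set.range C) ∪ {x | ∃ z ∈ Z, x ∈ A z}
  have hTcell : ∀ t ∈ T, t ∉ L → ∃ z ∈ Z, t ∈ A z := fun t ht htL => ht.resolve_left fun h =>
    htL h.1
  refine ⟨⟨Set.range C, T, lab, M, fun e => C e.1⟩, ⟨rfl, fun _ => rfl, rfl,
    ⟨fun e => ⟨e.1, rfl⟩, ?_, fun l hl hc => Or.inl ⟨hl, hc⟩, ?_, ?_, hρM⟩, ?_, ?_, ?_⟩, ?_⟩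
  · rintro t (ht | ⟨z, hz, ht⟩)
    exacts [ht.2, hAC z hz t ht]
  · intro l hl _ t ht h
    change lab t = lab l at h
    rw [hlabL l hl] at h
    rcases ht with ht | ⟨z, hz, ht⟩
    · rwa [hlabL t ht.1] at h
    · rw [hlab1 t z hz ht] at h
      exact absurd hl (h ▸ hAL z hz z (hA z hz).1)
  · intro v hv hvL t ht htL w hw
    obtain ⟨z, hz, htz⟩ := hTcell t ht htL
    by_contra! hlt
    exact hfarC v hv hvL z hz t htz ⟨w, hlt, hw⟩
  · intro a
    have hsub : {t | t ∈ T ∧ lab t = a} ⊆ ((if a ∈ Z then A a else {a} : Finset V) : Set V) := by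
      rintro t ⟨ht | ⟨z, hz, ht⟩, hta⟩
      · rw [hlabL t ht.1] at hta
        subst hta
        rw [if_neg fun h => hAL t h t (hA t h).1 ht.1]
        simp
      · rw [hlab1 t z hz ht] at hta
        subst hta
        rw [if_pos hz]
        exact ht
    refine (Set.ncard_le_ncard hsub).trans ?_
    rw [Set.ncard_coe_finset]
    split_ifs with h
    · exact (hA a h).2.1.le
    · simpa using hs
  · intro W U _ hW hU hWT
    refine ⟨((Z.filter fun z => z ∉ U).biUnion A : Finset V), ?_⟩
    have hcard : N ≤ ((Z.filter fun z => z ∉ U).biUnion A).card + 2 * k := by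
      have h1 : (Z.filter fun z => z ∉ U).card ≤ ((Z.filter fun z => z ∉ U).biUnion A).card := by
        rw [Finset.card_biUnion]
        · rw [Finset.card_eq_sum_ones]
          exact Finset.sum_le_sum fun z hz =>
            Finset.card_pos.2 ⟨z, (hA z (Finset.mem_filter.1 hz).1).1⟩
        · intro z hz z' hz' hne
          rw [Function.onFun, Finset.disjoint_left]
          intro x hx hx'
          have h2 := hlab1 x z (Finset.mem_filter.1 hz).1 hx
          have h3 := hlab1 x z' (Finset.mem_filter.1 hz').1 hx'
          exact hne (h2.symm.trans h3)
      have h2 := Finset.card_filter_add_card_filter_not (s := Z) (fun z => z ∈ U)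
      have h3 : (Z.filter fun z => z ∈ U).card ≤ U.ncard := by
        rw [← Set.ncard_coe_finset]
        exact Set.ncard_le_ncard fun z hz => (Finset.mem_filter.1 hz).2
      omega
    have hcard' : (N : ℝ) ≤ ((Z.filter fun z => z ∉ U).biUnion A).card + 2 * k := by
      exact_mod_cast hcard
    rw [Set.ncard_coe_finset]
    have hmem : ∀ y ∈ (((Z.filter fun z => z ∉ U).biUnion A : Finset V) : Set V),
        y ∈ T ∧ lab y ∉ U := by
      intro y hy
      obtain ⟨z, hz, hyz⟩ := Finset.mem_biUnion.1 (Finset.mem_coe.1 hy)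
      obtain ⟨hz, hzU⟩ := Finset.mem_filter.1 hz
      exact ⟨Or.inr ⟨z, hz, hyz⟩, by rwa [hlab1 y z hz hyz]⟩
    exact ⟨by linarith, by linarith, Set.disjoint_left.2 fun y hy hyW =>
      (hmem y hy).2 (hWT y (hmem y hy).1 hyW), fun y hy => Or.inl (hmem y hy)⟩
  · intro t ht htL
    obtain ⟨z, hz, htz⟩ := hTcell t ht htL
    exact ⟨A z, (hA z hz).2.1, htz, fun a ha => ⟨Or.inr ⟨z, hz, ha⟩,
      (hlab1 a z hz ha).trans (hlab1 t z hz htz).symm⟩, z, (hA z hz).2.2.2⟩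
  · intro t ht t' ht' htL htL' hne
    obtain ⟨z, hz, htz⟩ := hTcell t ht htL
    obtain ⟨z', hz', htz'⟩ := hTcell t' ht' htL'
    refine hfar z hz z' hz' (fun h => hne ?_) t htz t' htz'
    exact (hlab1 t z hz htz).trans (h.trans (hlab1 t' z' hz' htz').symm)

/-- N serves both as the number of cells and as a bound for the degrees outside L, which are below
ℓ^100. As some vertex lies outside L, also D < ℓ^100, so N exceeds the size needed for expansion. -/
theorem exists_goodFrame_of_few [Fintype V] {ρ s M N D : ℕ} {ε η ℓ : ℝ} (hs1 : 1 ≤ s)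
    (hρM : ρ ≤ M) (hℓ : 2 ≤ ℓ) (hD : ∀ x, D ≤ (G.neighborSet x).ncard)
    (hdeg : ∀ x, x ∉ L → ((G.neighborSet x).ncard : ℝ) < ℓ ^ 100) (hL : (L.ncard : ℝ) ≤ 2 * ℓ)
    (hk : (k : ℝ) ≤ ℓ / 4) (hG : Expands G ε (D / 2)) (hN : ℓ ^ 100 ≤ N)
    (hη : 0 ≤ η) (hs : (s : ℝ) ≤ (1 + η) ^ ρ)
    (hNs : ((N * s : ℕ) : ℝ) ≤ Fintype.card V / 2)
    (hgap : ∀ x : ℝ, N ≤ x → x ≤ (N * s : ℕ) →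
      3 * ℓ + η * x < ε * x / Real.log x ^ 2)
    (hcard : (2 * N + ℓ) * ((N : ℝ) + 1) ^ (4 * ρ) + 3 * ℓ ≤ Fintype.card V) :
    ∃ Φ : Frame V (Fin k × Fin 2), GoodFrame G C L ρ s M (D / 2) ℓ Φ ∧
      ∀ t ∈ Φ.T, ∀ t' ∈ Φ.T, t ∉ L → t' ∉ L → Φ.lab t ≠ Φ.lab t' → ¬ Near G L ρ t t' := by
  have hcore : (Set.range C).ncard = k := ncard_range_copy C
  have hLS : ((L ∪ Set.range C).ncard : ℝ) ≤ 3 * ℓ := by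
    have h1 : ((L ∪ Set.range C).ncard : ℝ) ≤ L.ncard + k := by
      have h := Set.ncard_union_le L (Set.range C)
      rw [hcore] at h
      exact_mod_cast h
    linarith
  have hpos : 0 < (2 * N + ℓ) * ((N : ℝ) + 1) ^ (4 * ρ) := by positivity
  have hDN : (D : ℝ) < ℓ ^ 100 := by
    obtain ⟨v, hv⟩ : ∃ v, v ∉ L := by
      by_contra! hcon
      have : L = Set.univ := Set.eq_univ_of_forall hcon
      rw [this, Set.ncard_univ, Nat.card_eq_fintype_card] at hL
      linarith
    refine lt_of_le_of_lt ?_ (hdeg v hv)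
    exact_mod_cast hD v
  have hbig : 4 * ℓ ^ 15 ≤ ℓ ^ 100 := by
    have h9 : (4:ℝ) ≤ ℓ ^ 2 := by nlinarith
    calc 4 * ℓ ^ 15 ≤ ℓ ^ 2 * ℓ ^ 15 := by gcongr
      _ = ℓ ^ 17 := by ring
      _ ≤ ℓ ^ 100 := pow_le_pow_right₀ (by linarith) (by norm_num)
  have hℓ15 : ℓ ≤ ℓ ^ 15 := le_self_pow₀ (by linarith) (by norm_num)
  obtain ⟨Z, A, hZ, hA, hfar, hfarC⟩ := exists_cells hG (L := L) (S := Set.range C) (Δ := N) hη hs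
    hs1 (by linarith) hNs (fun x h1 h2 => by linarith [hgap x h1 h2])
    (fun x hx => by
      have : ((G.neighborSet x).ncard : ℝ) ≤ N := (hdeg x hx).le.trans hN
      exact_mod_cast this)
    (by
      have h1 : (2 * (N:ℝ) + k) * ((N : ℝ) + 1) ^ (4 * ρ) + (L ∪ Set.range C).ncard ≤
          Fintype.card V := by
        refine le_trans ?_ hcard
        gcongr
        linarith
      rw [hcore]
      exact_mod_cast h1)
  exact exists_goodFrame_of_cells hs1 hρM hZ hA hfar hfarC (by linarith) (by linarith)

end KrakenLemma

/-! ### Numerical estimates -/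

namespace KrakenLemma

theorem exists_exp_threshold {c : ℝ} (hc : 0 < c) (B : ℝ) :
    ∃ T, 1 ≤ T ∧ B ≤ T ∧ ∀ t, T ≤ t → t ^ 500 ≤ Real.exp (t / 2) ∧ Real.log t ^ 2 ≤ c * t := by
  have h1 : ∀ᶠ t : ℝ in Filter.atTop, t ^ 500 ≤ Real.exp (t / 2) := by
    have h := (isLittleO_pow_exp_pos_mul_atTop (b := 1 / 2) 500 (by norm_num)).bound
      (show (0:ℝ) < 1 by norm_num)
    filter_upwards [h, Filter.eventually_ge_atTop 0] with t ht ht0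
    rw [Real.norm_of_nonneg (by positivity), Real.norm_of_nonneg (by positivity), one_mul] at ht
    rwa [show t / 2 = 1 / 2 * t by ring]
  have h2 : ∀ᶠ t : ℝ in Filter.atTop, Real.log t ^ 2 ≤ c * t := by
    filter_upwards [(Real.isLittleO_pow_log_id_atTop (n := 2)).bound hc,
      Filter.eventually_ge_atTop 0] with t ht ht0
    rw [Real.norm_of_nonneg (by positivity), id, Real.norm_of_nonneg ht0] at ht
    exact ht
  obtain ⟨T, hT⟩ := Filter.eventually_atTop.1 (h1.and h2)
  exact ⟨max T (max 1 B), le_max_of_le_right (le_max_left _ _),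
    le_max_of_le_right (le_max_right _ _), fun t ht => hT t ((le_max_left _ _).trans ht)⟩

theorem pow_le_exp_of_le {t y : ℝ} {j : ℕ} (ht1 : 1 ≤ t) (hexp : t ^ 500 ≤ Real.exp (t / 2))
    (hj : j ≤ 500) (hy : t / 2 ≤ y) : t ^ j ≤ Real.exp y :=
  (pow_le_pow_right₀ ht1 hj).trans (hexp.trans (Real.exp_le_exp.2 hy))

theorem mul_pow_le_pow_succ {t a : ℝ} {i j : ℕ} (ht : 1 ≤ t) (ha : a ≤ t) (hij : i + 1 ≤ j) :
    a * t ^ i ≤ t ^ j :=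
  calc a * t ^ i ≤ t * t ^ i := by gcongr
    _ = t ^ (i + 1) := (pow_succ' _ _).symm
    _ ≤ t ^ j := pow_le_pow_right₀ ht hij

/-- Here t = (log n)^(1/4), so R ≈ t², s ≈ t^40, N ≈ t^400, and the growth rate is η = 1/t. It is
large enough that (1 + η)^R beats powers of t, yet at most half of ε / log² x, because log x = O(log
t). The balls excluded in the choice of centres have total size exp(O(t³)), below n = exp(t^4). -/
theorem cell_numerics {t ε : ℝ} (hε : 0 < ε) (ht : 10000 ≤ t)
    (hexp : t ^ 500 ≤ Real.exp (t / 2)) (hlog : Real.log t ^ 2 ≤ ε / 400000 * t)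
    {R s N : ℕ} (hR : t ^ 2 ≤ R) (hR' : (R : ℝ) ≤ t ^ 2 + 1) (hs' : (s : ℝ) ≤ t ^ 40 + 1)
    (hN : t ^ 400 ≤ N) (hN' : (N : ℝ) ≤ t ^ 400 + 1) :
    (s : ℝ) ≤ (1 + 1 / t) ^ (R + 2) ∧ ((N * s : ℕ) : ℝ) ≤ Real.exp (t ^ 4) / 2 ∧
    (∀ x : ℝ, N ≤ x → x ≤ (N * s : ℕ) →
      3 * t ^ 4 + 1 / t * x < ε * x / Real.log x ^ 2) ∧
    (2 * N + t ^ 4) * ((N : ℝ) + 1) ^ (4 * (R + 2)) + 3 * t ^ 4 ≤ Real.exp (t ^ 4) := by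
  have ht1 : 1 ≤ t := by linarith
  have ht0 : 0 < t := by linarith
  have hpow1 : ∀ j : ℕ, 1 ≤ t ^ j := fun j => one_le_pow₀ ht1
  have hs2 : (s : ℝ) ≤ t ^ 41 := by
    have := mul_pow_le_pow_succ (a := 2) (i := 40) (j := 41) ht1 (by linarith) le_rfl
    linarith [hpow1 40]
  have hN2 : (N : ℝ) + 1 ≤ t ^ 401 := by
    have := mul_pow_le_pow_succ (a := 3) (i := 400) (j := 401) ht1 (by linarith) le_rfl
    linarith [hpow1 400]
  have hNs : ((N * s : ℕ) : ℝ) ≤ t ^ 442 := by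
    push_cast
    calc (N : ℝ) * s ≤ t ^ 401 * t ^ 41 := by gcongr; linarith
      _ = t ^ 442 := by rw [← pow_add]
  have ht4 : t ≤ t ^ 4 := le_self_pow₀ ht1 (by norm_num)
  refine ⟨?_, ?_, ?_, ?_⟩
  · refine le_trans ?_ (one_add_pow_ge_exp (by positivity) (by rw [div_le_one ht0]; exact ht1) _)
    refine hs2.trans (pow_le_exp_of_le ht1 hexp (by norm_num) ?_)
    push_cast
    rw [mul_one_div, div_div, le_div_iff₀ (by positivity)]
    nlinarith
  · refine hNs.trans ?_
    have h1 := mul_pow_le_pow_succ (a := 2) (i := 442) (j := 443) ht1 (by linarith) le_rfl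
    have h2 := pow_le_exp_of_le (y := t ^ 4) (j := 443) ht1 hexp (by norm_num) (by linarith)
    linarith
  · intro x hx hx'
    have hxt : t ^ 400 ≤ x := hN.trans hx
    have hx1 : 1 < x := lt_of_lt_of_le (one_lt_pow₀ (by linarith) (by norm_num)) hxt
    have hl0 : 0 < Real.log x := Real.log_pos hx1
    have hl : Real.log x ≤ 442 * Real.log t := by
      have := Real.log_le_log (by linarith) (hx'.trans hNs)
      rwa [Real.log_pow] at this
    have h1 : 3 * t ^ 4 < 1 / t * x := by
      rw [one_div, ← div_eq_inv_mul, lt_div_iff₀ ht0]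
      have h2 := mul_pow_le_pow_succ (a := 4) (i := 5) (j := 400) ht1 (by linarith) (by norm_num)
      have h3 : 0 < t ^ 5 := by positivity
      linarith [show 3 * t ^ 4 * t = 3 * t ^ 5 by ring]
    have h2 : 2 / t * x ≤ ε * x / Real.log x ^ 2 := by
      rw [le_div_iff₀ (by positivity)]
      have h3 : Real.log x ^ 2 ≤ ε * t / 2 := by
        calc Real.log x ^ 2 ≤ (442 * Real.log t) ^ 2 := by gcongr
          _ = 195364 * Real.log t ^ 2 := by ring
          _ ≤ 195364 * (ε / 400000 * t) := by gcongr
          _ ≤ ε * t / 2 := by nlinarith [mul_pos hε ht0]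
      calc 2 / t * x * Real.log x ^ 2 ≤ 2 / t * x * (ε * t / 2) := by gcongr
        _ = ε * x := by field_simp
    have h3 : 2 / t * x = 1 / t * x + 1 / t * x := by ring
    linarith
  · have h1 : (2 * N + t ^ 4 : ℝ) ≤ t ^ 402 := by
      have h2 := mul_pow_le_pow_succ (a := 3) (i := 401) (j := 402) ht1 (by linarith) le_rfl
      have h3 : t ^ 4 ≤ t ^ 401 := pow_le_pow_right₀ ht1 (by norm_num)
      linarith
    have h2 : t ≤ Real.exp t := by linarith [Real.add_one_le_exp t]
    have h3 : ((N : ℝ) + 1) ^ (4 * (R + 2)) ≤ Real.exp (2005 * t ^ 3) := by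
      calc ((N : ℝ) + 1) ^ (4 * (R + 2)) ≤ ((Real.exp t) ^ 401) ^ (4 * (R + 2)) := by
            gcongr
            exact hN2.trans (by gcongr)
        _ = Real.exp ((401 * (4 * (R + 2)) : ℕ) * t) := by
            rw [← pow_mul, ← Real.exp_nat_mul]
        _ ≤ Real.exp (2005 * t ^ 3) := by
            apply Real.exp_le_exp.2
            push_cast
            have : (4 * (R + 2) : ℝ) ≤ 5 * t ^ 2 := by nlinarith
            calc (401 * (4 * ((R:ℝ) + 2))) * t ≤ (401 * (5 * t ^ 2)) * t := by gcongr
              _ = 2005 * t ^ 3 := by ring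
    have h4 : t ^ 402 ≤ Real.exp (t / 2) := pow_le_exp_of_le ht1 hexp (by norm_num) le_rfl
    have h5 : 3 * t ^ 4 ≤ Real.exp (t ^ 4) / 2 := by
      have h6 := mul_pow_le_pow_succ (a := 6) (i := 4) (j := 5) ht1 (by linarith) le_rfl
      have h7 := pow_le_exp_of_le (y := t ^ 4) (j := 5) ht1 hexp (by norm_num) (by linarith)
      linarith
    have h6 : (2 * N + t ^ 4) * ((N : ℝ) + 1) ^ (4 * (R + 2)) ≤ Real.exp (t ^ 4) / 2 := by
      have h7 : Real.exp (t / 2) * Real.exp (2005 * t ^ 3) * Real.exp 1 ≤ Real.exp (t ^ 4) := by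
        rw [← Real.exp_add, ← Real.exp_add]
        apply Real.exp_le_exp.2
        have h8 : 10000 * t ^ 3 ≤ t ^ 4 := by
          have : 0 < t ^ 3 := by positivity
          nlinarith
        have h9 : t ≤ t ^ 3 := le_self_pow₀ ht1 (by norm_num)
        linarith
      have h8 : (2:ℝ) ≤ Real.exp 1 := by linarith [Real.add_one_le_exp (1:ℝ)]
      have h9 : 0 < Real.exp (t / 2) * Real.exp (2005 * t ^ 3) := by positivity
      have h10 : (2 * N + t ^ 4) * ((N : ℝ) + 1) ^ (4 * (R + 2)) ≤
          Real.exp (t / 2) * Real.exp (2005 * t ^ 3) := by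
        gcongr
        exact h1.trans h4
      nlinarith
    linarith

/-- With ℓ = t^4, the growth (δR)^40 is about δ^40 ℓ^20 and exceeds ℓ^15. The part to avoid is O(k(M
+ s)), with k ≤ ℓ/4 and s ≈ ℓ^10, hence at most ℓ^12. -/
theorem linkage_numerics {t ε δ : ℝ} (hε : 0 < ε) (hε1 : ε < 1) (hδ : 0 < δ) (ht : 10000 ≤ t)
    (htε : 10000 / ε ≤ t) (htδ : δ⁻¹ ^ 2 ≤ t)
    (hexp : t ^ 500 ≤ Real.exp (t / 2))
    {R s M : ℕ} (hR : t ^ 2 ≤ R) (hR' : (R : ℝ) ≤ t ^ 2 + 1) (hs' : (s : ℝ) ≤ t ^ 40 + 1)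
    (hM : (M : ℝ) ≤ 1000 * ε⁻¹ * t ^ 12) (hM' : 1000 * ε⁻¹ * t ^ 12 ≤ M + 1) :
    2 ≤ ε * t ^ 4 ∧ (t ^ 4) ^ 15 ≤ (δ * R) ^ 40 ∧ (t ^ 4) ^ 15 ≤ 2 ^ R ∧
    (t ^ 4) ^ 15 ≤ Real.exp (t ^ 4) / 2 ∧
    (∀ k : ℕ, (k : ℝ) ≤ t ^ 4 / 4 → (k : ℝ) + 2 * k * M + 2 * k * s ≤ (t ^ 4) ^ 12) ∧
    R + 2 * ⌈4 * (t ^ 4) ^ 3 / ε⌉₊ + 4 ≤ M ∧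
    2 * ((R + 2 : ℕ) : ℝ) ≤ 100 * ε⁻¹ * (t ^ 4) ^ 3 := by
  have ht1 : 1 ≤ t := by linarith
  have ht0 : 0 < t := by linarith
  have hpow1 : ∀ j : ℕ, 1 ≤ t ^ j := fun j => one_le_pow₀ ht1
  have ht4 : t ≤ t ^ 4 := le_self_pow₀ ht1 (by norm_num)
  have hεt : 10000 ≤ ε * t := by rwa [div_le_iff₀' hε] at htε
  have hεinv : ε⁻¹ ≤ t := by
    rw [inv_le_iff_one_le_mul₀ hε]; nlinarith
  have hεinv1 : 1 ≤ ε⁻¹ := (one_le_inv₀ hε).2 hε1.le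
  have hR3 : (R : ℝ) ≤ t ^ 3 := by
    have := mul_pow_le_pow_succ (a := 2) (i := 2) (j := 3) ht1 (by linarith) le_rfl
    linarith [hpow1 2]
  have ht3 : t ^ 3 ≤ t ^ 12 := pow_le_pow_right₀ ht1 (by norm_num)
  have hbase : t ^ 12 ≤ ε⁻¹ * t ^ 12 := le_mul_of_one_le_left (by positivity) hεinv1
  have ht12 : (100:ℝ) ≤ t ^ 12 := by
    linarith [le_self_pow₀ ht1 (show (12:ℕ) ≠ 0 by norm_num)]
  refine ⟨?_, ?_, ?_, ?_, ?_, ?_, ?_⟩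
  · nlinarith
  · have h1 : t ^ 60 ≤ (δ * t ^ 2) ^ 40 := by
      have h2 : 1 ≤ (δ ^ 2 * t) ^ 20 := by
        apply one_le_pow₀
        rw [inv_pow, inv_le_iff_one_le_mul₀ (by positivity)] at htδ
        linarith
      calc t ^ 60 = 1 * t ^ 60 := (one_mul _).symm
        _ ≤ (δ ^ 2 * t) ^ 20 * t ^ 60 := by gcongr
        _ = (δ * t ^ 2) ^ 40 := by ring
    calc (t ^ 4) ^ 15 = t ^ 60 := by rw [← pow_mul]
      _ ≤ _ := h1
      _ ≤ _ := by gcongr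
  · have h1 : Real.exp (t / 2) ≤ 2 ^ R := by
      have h2 := one_add_pow_ge_exp (δ := 1) (by norm_num) le_rfl R
      norm_num at h2
      refine le_trans (Real.exp_le_exp.2 ?_) h2
      nlinarith
    rw [← pow_mul]
    exact (pow_le_exp_of_le ht1 hexp (by norm_num) le_rfl).trans h1
  · have h1 := mul_pow_le_pow_succ (a := 2) (i := 60) (j := 61) ht1 (by linarith) le_rfl
    have h2 := pow_le_exp_of_le (y := t ^ 4) (j := 61) ht1 hexp (by norm_num) (by linarith)
    rw [← pow_mul]
    linarith
  · intro k hk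
    have hk0 : (0:ℝ) ≤ k := by positivity
    have hM2 : (M : ℝ) ≤ t ^ 14 := by
      calc (M : ℝ) ≤ 1000 * ε⁻¹ * t ^ 12 := hM
        _ ≤ t * t * t ^ 12 := by gcongr; linarith
        _ = t ^ 14 := by ring
    have hM3 : (M : ℝ) ≤ t ^ 41 := hM2.trans (pow_le_pow_right₀ ht1 (by norm_num))
    have hs2 : (s : ℝ) ≤ t ^ 41 := by
      have := mul_pow_le_pow_succ (a := 2) (i := 40) (j := 41) ht1 (by linarith) le_rfl
      linarith [hpow1 40]
    have h1 : (k : ℝ) + 2 * k * M + 2 * k * s ≤ 5 * (t ^ 4 * t ^ 41) := by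
      have hk' : (k:ℝ) ≤ t ^ 4 := by linarith [hpow1 4]
      have a1 : (k:ℝ) * M ≤ t ^ 4 * t ^ 41 := by gcongr
      have a2 : (k:ℝ) * s ≤ t ^ 4 * t ^ 41 := by gcongr
      have a3 : (k:ℝ) * 1 ≤ t ^ 4 * t ^ 41 := by gcongr; exact hpow1 41
      linarith
    refine h1.trans ?_
    rw [← pow_add, ← pow_mul]
    exact mul_pow_le_pow_succ ht1 (by linarith) (by norm_num)
  · have hc : (⌈4 * (t ^ 4) ^ 3 / ε⌉₊ : ℝ) ≤ 4 * ε⁻¹ * t ^ 12 + 1 := by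
      have := (Nat.ceil_lt_add_one (a := 4 * (t ^ 4) ^ 3 / ε) (by positivity)).le
      rw [← pow_mul, div_eq_mul_inv] at this
      rw [← pow_mul, div_eq_mul_inv]
      linarith
    have : ((R + 2 * ⌈4 * (t ^ 4) ^ 3 / ε⌉₊ + 4 : ℕ) : ℝ) ≤ M := by
      push_cast
      linarith
    exact_mod_cast this
  · rw [← pow_mul]
    push_cast
    linarith

end KrakenLemma

/-! ### The choice of the cycle and the final proof -/

namespace KrakenLemma

theorem ncard_neighborSet {V : Type*} [Fintype V] (G : SimpleGraph V) [DecidableRel G.Adj] (x : V) :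
    (G.neighborSet x).ncard = G.degree x := by
  rw [Set.ncard_eq_toFinset_card', Set.toFinset_card, G.card_neighborSet_eq_degree]

theorem exists_short_cycle_copy {V : Type*} [Fintype V] [Nonempty V] {G : SimpleGraph V} {D : ℕ}
    {ℓ : ℝ} (hℓ : ℓ = Real.log (Fintype.card V)) (hℓ1 : 100 ≤ ℓ)
    (hD : ∀ x, D ≤ (G.neighborSet x).ncard) (hD32 : Real.exp 32 ≤ (D : ℝ) - 1) :
    ∃ k : ℕ, 3 ≤ k ∧ (k : ℝ) ≤ ℓ / 4 ∧ (∀ (a : V) (c : G.Walk a a), c.IsCycle → k ≤ c.length) ∧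
      Nonempty (Copy (cycleGraph k) G) := by
  have h32 : (33:ℝ) ≤ Real.exp 32 := by linarith [Real.add_one_le_exp (32:ℝ)]
  have hD1 : 1 ≤ D := by
    have : (1:ℝ) ≤ D := by linarith
    exact_mod_cast this
  have hn : 0 < (Fintype.card V : ℝ) := by exact_mod_cast Fintype.card_pos
  have hfloor := Nat.lt_floor_add_one (ℓ / 32)
  have hfloor' := Nat.floor_le (a := ℓ / 32) (by linarith)
  -- As D - 1 ≥ e^32, this depth exceeds n in the tree count and gives k ≤ ℓ/16 + 4.
  obtain ⟨k, hk3, hk, hg, hC⟩ := exists_shortest_cycle (R := ⌊ℓ / 32⌋₊ + 1) hD hD1 (by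
    have h1 : (Fintype.card V : ℝ) < ((D:ℝ) - 1) ^ (⌊ℓ / 32⌋₊ + 1) := by
      calc (Fintype.card V : ℝ) = Real.exp ℓ := by rw [hℓ, Real.exp_log hn]
        _ < Real.exp ((⌊ℓ / 32⌋₊ + 1 : ℕ) * 32) := by
            apply Real.exp_lt_exp.2
            push_cast
            linarith
        _ = Real.exp 32 ^ (⌊ℓ / 32⌋₊ + 1) := Real.exp_nat_mul _ _
        _ ≤ _ := by gcongr
    have h2 : (((D - 1 : ℕ) : ℝ)) = D - 1 := by rw [Nat.cast_sub hD1]; simp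
    rw [← h2] at h1
    exact_mod_cast h1)
  refine ⟨k, hk3, ?_, hg, hC⟩
  have : (k:ℝ) ≤ 2 * (⌊ℓ / 32⌋₊ + 1) + 2 := by exact_mod_cast hk
  linarith

theorem distAtLeast_induce_of_not_near {V : Type*} {G : SimpleGraph V} {L : Set V} {ρ : ℕ} {t : ℝ}
    (ht : t ≤ ρ) {x y : V} (hx : x ∈ Lᶜ) (hy : y ∈ Lᶜ) (h : ¬ Near G L ρ x y) :
    DistAtLeast (G.induce Lᶜ) ⟨x, hx⟩ ⟨y, hy⟩ t := by
  intro w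
  by_contra! hlt
  have hw : (w.map (Embedding.induce Lᶜ).toHom).length = w.length := Walk.length_map _ _
  have hs : (w.map (Embedding.induce Lᶜ).toHom).support = w.support.map _ := Walk.support_map _ _
  refine h ⟨w.map (Embedding.induce Lᶜ).toHom, ?_, fun z hz => ?_⟩
  · refine hw.le.trans ?_
    exact_mod_cast (hlt.trans_le ht).le
  · obtain ⟨a, -, rfl⟩ := List.mem_map.1 (hs ▸ hz)
    exact a.2

end KrakenLemma

open KrakenLemma in
theorem lemma3p2 (ε₁ : ℝ) (hε₀ : 0 < ε₁) (hε₁ : ε₁ < 1) :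
    ∃ d₀ : ℝ, 0 < d₀ ∧ ∀ d : ℝ, d₀ ≤ d →
      ∀ (V : Type*) [Fintype V] [Nonempty V] (G : SimpleGraph V) [DecidableRel G.Adj],
        KrakenLemma.IsExpander G ε₁ (ε₁ * d) →
        d ≤ (G.minDegree : ℝ) →
        ∃ (k : ℕ) (K : KrakenLemma.Kraken G k
            (100 * ε₁⁻¹ * Real.log (Fintype.card V) ^ 3)
            ⌈Real.log (Fintype.card V) ^ 10⌉₊),
          (k : ℝ) ≤ Real.log (Fintype.card V) ∧
          ((∀ i j, K.u i j ∈ KrakenLemma.highDegree G) ∨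
            (((KrakenLemma.highDegree G).ncard : ℝ) ≤ 2 * Real.log (Fintype.card V) ∧
              ∀ i j i' j', (i, j) ≠ (i', j') →
                ∀ (h : K.u i j ∈ (KrakenLemma.highDegree G)ᶜ)
                  (h' : K.u i' j' ∈ (KrakenLemma.highDegree G)ᶜ),
                  KrakenLemma.DistAtLeast (G.induce (KrakenLemma.highDegree G)ᶜ)
                    ⟨K.u i j, h⟩ ⟨K.u i' j', h'⟩
                    (Real.sqrt (Real.log (Fintype.card V))))) := by
  obtain ⟨Y, δ, hY, hδ, hδ1, hstep⟩ := exists_growth_constants hε₀ hε₁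
  obtain ⟨T, hT1, hTB, hT⟩ := exists_exp_threshold (c := ε₁ / 400000) (by positivity)
    (max 10000 (max (10000 / ε₁) (δ⁻¹ ^ 2)))
  -- In turn: n ≥ d makes log n ≥ T^4; the rate simplifies to ε / log² x; the growth induction can
  -- start; the girth is logarithmic.
  refine ⟨max (Real.exp (T ^ 4)) (max (15 / ε₁) (max ((2 * (Y + 30)) ^ 40 + 1) (Real.exp 32 + 1))),
    lt_max_of_lt_left (Real.exp_pos _), ?_⟩
  intro d hd V _ _ G _ hG hdD
  simp only [max_le_iff] at hd hTB
  obtain ⟨hd1, hd2, hd3, hd4⟩ := hd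
  obtain ⟨hT2, hT3, hT4⟩ := hTB
  set L := highDegree G with hLdef
  set ℓ := Real.log (Fintype.card V) with hℓ
  set D := G.minDegree with hDdef
  have hn0 : 0 < (Fintype.card V : ℝ) := by exact_mod_cast Fintype.card_pos
  have hn : Real.exp ℓ = Fintype.card V := Real.exp_log hn0
  have hdn : d ≤ Fintype.card V := hdD.trans (by exact_mod_cast (G.minDegree_lt_card).le)
  have hTℓ : T ^ 4 ≤ ℓ := by
    rw [hℓ, Real.le_log_iff_exp_le hn0]
    exact hd1.trans hdn
  obtain ⟨t, ht0, htℓ⟩ : ∃ t : ℝ, 0 ≤ t ∧ t ^ 4 = ℓ := by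
    have h0 : 0 ≤ ℓ := le_trans (by positivity) hTℓ
    refine ⟨√√ℓ, by positivity, ?_⟩
    rw [show √√ℓ ^ 4 = (√√ℓ ^ 2) ^ 2 by ring, Real.sq_sqrt (by positivity), Real.sq_sqrt h0]
  have hTt : T ≤ t := le_of_pow_le_pow_left₀ (by norm_num) ht0 (hTℓ.trans htℓ.ge)
  obtain ⟨hexp, hlog⟩ := hT t hTt
  have ht : 10000 ≤ t := hT2.trans hTt
  have ht1 : 1 ≤ t := by linarith
  have htℓ' : t ≤ ℓ := htℓ ▸ le_self_pow₀ ht1 (by norm_num)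
  have hℓ0 : 0 < ℓ := by linarith
  have hsqrt : √ℓ = t ^ 2 := by
    rw [← htℓ, show t ^ 4 = (t ^ 2) ^ 2 by ring, Real.sqrt_sq (by positivity)]
  obtain ⟨R, hR, hR'⟩ : ∃ R : ℕ, t ^ 2 ≤ R ∧ (R : ℝ) ≤ t ^ 2 + 1 :=
    ⟨_, Nat.le_ceil _, (Nat.ceil_lt_add_one (by positivity)).le⟩
  have hs' : (⌈ℓ ^ 10⌉₊ : ℝ) ≤ t ^ 40 + 1 := by
    have := (Nat.ceil_lt_add_one (a := ℓ ^ 10) (by positivity)).le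
    rwa [show t ^ 40 = ℓ ^ 10 by rw [← htℓ, ← pow_mul]]
  have hs1 : 1 ≤ ⌈ℓ ^ 10⌉₊ := Nat.one_le_ceil_iff.2 (by positivity)
  generalize ⌈ℓ ^ 10⌉₊ = s at hs' hs1 ⊢
  obtain ⟨N, hN, hN'⟩ : ∃ N : ℕ, t ^ 400 ≤ N ∧ (N : ℝ) ≤ t ^ 400 + 1 :=
    ⟨_, Nat.le_ceil _, (Nat.ceil_lt_add_one (by positivity)).le⟩
  -- M is the integer part of 10m, the length allowed for an arm.
  obtain ⟨M, hM, hM'⟩ : ∃ M : ℕ, (M : ℝ) ≤ 1000 * ε₁⁻¹ * t ^ 12 ∧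
      1000 * ε₁⁻¹ * t ^ 12 ≤ M + 1 :=
    ⟨_, Nat.floor_le (by positivity), (Nat.lt_floor_add_one _).le⟩
  obtain ⟨c1, c2, c3, c4⟩ := cell_numerics hε₀ ht hexp hlog hR hR' hs' hN hN'
  obtain ⟨l1, l2, l3, l4, l5, l6, l7⟩ := linkage_numerics hε₀ hε₁ hδ ht (hT3.trans hTt)
    (hT4.trans hTt) hexp hR hR' hs' hM hM'
  rw [show t ^ 12 = (t ^ 4) ^ 3 by ring] at hM
  rw [show t ^ 400 = (t ^ 4) ^ 100 by rw [← pow_mul]] at hN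
  rw [htℓ] at c2 c3 c4 l1 l2 l3 l4 l5 l6 l7 hM hN
  rw [hn] at c2 c4 l4
  have hR1 : 1 ≤ R := by
    have : (1:ℝ) ≤ R := le_trans (one_le_pow₀ ht1) hR
    exact_mod_cast this
  have hD : ∀ x, D ≤ (G.neighborSet x).ncard := fun x => by
    rw [ncard_neighborSet]; exact G.minDegree_le_degree x
  have hexpand : Expands G ε₁ (D / 2) := fun X hX hX' =>
    hG.expands hε₀ hε₁ hd2 X (le_trans (by linarith) hX) hX'
  have hdegL : ∀ l ∈ L, ℓ ^ 100 ≤ ((G.neighborSet l).ncard : ℝ) := fun l hl => by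
    rw [ncard_neighborSet]; exact hl
  have hdegL' : ∀ x, x ∉ L → ((G.neighborSet x).ncard : ℝ) < ℓ ^ 100 := fun x hx => by
    rw [ncard_neighborSet]; exact not_le.1 hx
  obtain ⟨k, hk3, hk, hg, ⟨C⟩⟩ := exists_short_cycle_copy hℓ (by linarith) hD (by linarith)
  have hρM : R + 2 ≤ M := by omega
  have hframe : ∃ Φ : Frame V (Fin k × Fin 2), GoodFrame G C L (R + 2) s M (D / 2) ℓ Φ ∧
      ((∀ t ∈ Φ.T, t ∈ L) ∨ ((L.ncard : ℝ) ≤ 2 * ℓ ∧ ∀ t ∈ Φ.T, ∀ t' ∈ Φ.T, t ∉ L → t' ∉ L →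
        Φ.lab t ≠ Φ.lab t' → ¬ Near G L (R + 2) t t')) := by
    by_cases hL : 2 * ℓ < L.ncard
    · obtain ⟨Φ, hΦ, h⟩ := exists_goodFrame_of_many (C := C) hs1 hρM (by linarith) hD hdegL hL hk
      exact ⟨Φ, hΦ, Or.inl h⟩
    · push Not at hL
      obtain ⟨Φ, hΦ, h⟩ := exists_goodFrame_of_few (C := C) hs1 hρM (by linarith) hD hdegL' hL hk
        hexpand hN (by positivity) c1 c2 c3 c4
      exact ⟨Φ, hΦ, Or.inr ⟨hL, h⟩⟩
  obtain ⟨Φ, hΦ, hΦL⟩ := hframe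
  obtain ⟨F, hF⟩ := Φ.exists_isOptimal G
  have hne := hF.ne_none hΦ.sep hΦ.core_eq hΦ.start_eq hg hD hε₀ hε₁ hexpand hY hδ hδ1 hstep
    (by linarith) hR1 hℓ l1 l2 l3 l4 hΦ.fiber hdegL (by rw [hΦ.M_eq]; exact l5 k hk)
    (by rw [hΦ.M_eq]; exact l6) hΦ.rich
  choose b hb using fun e => Option.ne_none_iff_exists'.1 (hne e)
  have hbT : ∀ e, (b e).lst ∈ Φ.T := fun e => (hF.1.isArm e (b e) (hb e)).lst_mem
  obtain ⟨K, hK⟩ := exists_kraken (m := 100 * ε₁⁻¹ * ℓ ^ 3) (r := R + 2) hk3 hs1 C hΦ.core_eq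
    hΦ.start_eq hΦ.sep.disj hF.1 hb (L := L) (by omega) l7
    (by rw [hΦ.M_eq]; linarith) (fun l hl => by
      have h1 := l5 k hk
      have h2 := hdegL l hl
      have h3 : 2 * ℓ ^ 12 ≤ ℓ ^ 100 := by
        have := mul_pow_le_pow_succ (t := ℓ) (a := 2) (i := 12) (j := 100) (by linarith)
          (by linarith) (by norm_num)
        exact this
      have h4 : (0:ℝ) ≤ k := by positivity
      have h5 : (0:ℝ) ≤ k * M := by positivity
      rw [hΦ.M_eq]
      have h6 : (k : ℝ) + 2 * k * M + 4 * k * s ≤ (G.neighborSet l).ncard := by linarith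
      exact_mod_cast h6) hΦ.cell
  refine ⟨k, K, by linarith, ?_⟩
  rcases hΦL with h | ⟨hL, h⟩
  · exact Or.inl fun i j => by rw [hK]; exact h _ (hbT _)
  · refine Or.inr ⟨hL, fun i j i' j' hij hu hu' => ?_⟩
    refine distAtLeast_induce_of_not_near (ρ := R + 2) ?_ hu hu' ?_
    · rw [hsqrt]; push_cast; linarith
    · rw [hK, hK]
      refine h _ (hbT _) _ (hbT _) (fun h' => hu (by rwa [hK])) (fun h' => hu' (by rwa [hK])) ?_
      -- Different arms end at different labels, hence in different cells, which are farther apart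
      -- than R + 2 ≥ √(log n) in G - L.
      exact (hF.1.disj _ _ _ _ hij (hb _) (hb _)).2
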